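/- For $h>0$ let $\phi_h(z)=\frac{1}{\sqrt{2\pi}\,h}e^{-z^2/(2h^2)}$. For each $n$ let $G_\mu=G_{\mu,n}$ and $G_\sigma=G_{\sigma,n}$ be probability measures on $\mathbb R$ (they may, but need not, depend on $n$), and let $(X_i,\mu_i,\sigma_i)$, $1\le i\le n$, be i.i.d. triples such that $\mu_i\sim G_\mu$ and $\sigma_i\sim G_\sigma$ are independent and $X_i\mid(\mu_i,\sigma_i)\sim N(\mu_i,\sigma_i^2)$. Assume that 1. $|\mu_i|\le C_n$ almost surely, where $C_n=o(n^\epsilon)$ for every $\epsilon>0$; 2. $\sigma_l\le\sigma_i\le\sigma_u$ almost surely, with constants $0<\sigma_l\le\sigma_u<\infty$ that do not depend on $n$. Let $h_x=h_{x,n}>0$ and $h_\sigma=h_{\sigma,n}>0$ be deterministic bandwidths of exact orders $n^{-\eta_x}$ and $n^{-\eta_s}$ (bounded above and below by positive constant multiples of these), where $\eta_x,\eta_s>0$ are constants that are small in the sense that $3\eta_x+\eta_s<1$ (in particular $0<\eta_x+\eta_s<1$). Put $$\hat f_{\sigma}(x)=\sum_{j=1}^n w_j(\sigma)\,\phi_{h_x\sigma_j}(x-X_j),\qquad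 w_j(\sigma)=\frac{\phi_{h_\sigma}(\sigma-\sigma_j)}{\sum_{k=1}^n\phi_{h_\sigma}(\sigma-\sigma_k)},$$ and let the truncated NEST estimator $\hat{\boldsymbol\delta}=(\hat\delta_1,\dots,\hat\delta_n)$ be $$\hat\delta_i=\max\Bigl\{-T_n,\ \min\Bigl\{T_n,\ X_i+\sigma_i^2\,\frac{\hat f_{\sigma_i}^{(1)}(X_i)}{\hat f_{\sigma_i}(X_i)}\Bigr\}\Bigr\},$$ where $\hat f^{(1)}_\sigma$ is the derivative of $\hat f_\sigma$ in $x$, and the truncation levels satisfy $T_n\ge C_n$ for all large $n$ and $T_n=o(n^\epsilon)$ for every $\epsilon>0$ (for example $T_n=C_n+\log n$, or $T_n=K\log n$ if $C_n\le K\log n$). Let $f_\sigma(x)=\int\phi_\sigma(x-\mu)\,dG_\mu(\mu)$, let $\delta^\pi(x,\sigma)=x+\sigma^2 f_\sigma^{(1)}(x)/f_\sigma(x)$ be the oracle rule, and let $(X,\mu,\sigma)$ be a generic triple of the model. Then the compound Bayes risk $r(\hat{\boldsymbol\delta},G)=\mathbb E\bigl\{n^{-1}\sum_{i=1}^n(\hat\delta_i-\mu_i)^2\bigr\}$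 and the oracle Bayes risk $r(\delta^\pi,G)=\mathbb E\bigl\{(\delta^\pi(X,\sigma)-\mu)^2\bigr\}$ are finite for every $n$, and $\hat{\boldsymbol\delta}$ is asymptotically optimal: $$\lim_{n\to\infty}\bigl\{r(\hat{\boldsymbol\delta},G)-r(\delta^\pi,G)\bigr\}=0 .$$ -/

import Mathlib

open MeasureTheory Filter Topology Asymptotics

noncomputable section

namespace NEST

/-- The Gaussian kernel `φ_h(z)`, the density at `z` of the normal law with mean `0` and standard
deviation `h` (for `h > 0`). -/
def phi (h z : ℝ) : ℝ :=
  1 / (Real.sqrt (2 * Real.pi) * h) * Real.exp (-z ^ 2 / (2 * h ^ 2))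

/-! ### The hierarchical model -/

/-- The joint law of a generic triple `(X, μ, σ)`: `μ ∼ Gμ` and `σ ∼ Gσ` are independent, and
`X` given `(μ, σ)` is normal with mean `μ` and variance `σ ^ 2`; that is, the law
`φ_σ(x - μ) dx dGμ(μ) dGσ(σ)`. -/
def tripleLaw (Gμ Gσ : Measure ℝ) : Measure (ℝ × ℝ × ℝ) :=
  ((volume : Measure ℝ).prod (Gμ.prod Gσ)).withDensity
    fun p => ENNReal.ofReal (phi p.2.2 (p.1 - p.2.1))

/-- The joint law of `n` independent triples `D i = (X i, μ i, σ i)`. -/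
def sampleLaw (n : ℕ) (Gμ Gσ : Measure ℝ) : Measure (Fin n → ℝ × ℝ × ℝ) :=
  Measure.pi fun _ => tripleLaw Gμ Gσ

/-! ### The oracle rule -/

/-- The marginal density `f_σ(x) = ∫ φ_σ(x - μ) dGμ(μ)`. -/
def marginal (Gμ : Measure ℝ) (σ x : ℝ) : ℝ :=
  ∫ m, phi σ (x - m) ∂Gμ

/-- The oracle (Bayes) rule `x + σ² f_σ'(x) / f_σ(x)`. -/
def oracle (Gμ : Measure ℝ) (x σ : ℝ) : ℝ :=
  x + σ ^ 2 * (deriv (marginal Gμ σ) x / marginal Gμ σ x)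

/-- The squared error of the oracle rule on a triple `(x, μ, σ)`. -/
def oracleLoss (Gμ : Measure ℝ) (p : ℝ × ℝ × ℝ) : ℝ :=
  (oracle Gμ p.1 p.2.2 - p.2.1) ^ 2

/-- The oracle Bayes risk `E (δ^π(X, σ) - μ)²`. -/
def oracleRisk (Gμ Gσ : Measure ℝ) : ℝ :=
  ∫ p, oracleLoss Gμ p ∂tripleLaw Gμ Gσ

/-! ### The NEST rule -/

/-- The weight of the `j`-th observation,
`φ_{hs}(σ - s j) / ∑ k, φ_{hs}(σ - s k)`. -/
def weight {n : ℕ} (hs : ℝ) (s : Fin n → ℝ) (σ : ℝ) (j : Fin n) : ℝ :=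
  phi hs (σ - s j) / ∑ k, phi hs (σ - s k)

/-- The weighted kernel density estimate of `f_σ` at `t`, from the observations `(x j, s j)`. -/
def kde {n : ℕ} (hx hs : ℝ) (x s : Fin n → ℝ) (σ t : ℝ) : ℝ :=
  ∑ j, weight hs s σ j * phi (hx * s j) (t - x j)

/-- The rule obtained by plugging the density estimate into Tweedie's formula. -/
def nestRaw {n : ℕ} (hx hs : ℝ) (x s : Fin n → ℝ) (i : Fin n) : ℝ :=
  x i + s i ^ 2 * (deriv (kde hx hs x s (s i)) (x i) / kde hx hs x s (s i) (x i))

/-- The truncated rule: each coordinate is clipped to the interval `[-T, T]`. -/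
def nest {n : ℕ} (T hx hs : ℝ) (x s : Fin n → ℝ) (i : Fin n) : ℝ :=
  max (-T) (min T (nestRaw hx hs x s i))

/-! ### Compound risk -/

/-- The compound loss `n⁻¹ ‖δ(x, s) - μ‖²` of a compound decision rule `δ`, as a function of
the full data. -/
def compoundLoss {n : ℕ} (δ : (Fin n → ℝ) → (Fin n → ℝ) → Fin n → ℝ)
    (D : Fin n → ℝ × ℝ × ℝ) : ℝ :=
  (n : ℝ)⁻¹ * ∑ i, (δ (fun j => (D j).1) (fun j => (D j).2.2) i - (D i).2.1) ^ 2

/-- The compound Bayes risk of a compound decision rule. -/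
def compoundRisk {n : ℕ} (δ : (Fin n → ℝ) → (Fin n → ℝ) → Fin n → ℝ)
    (Gμ Gσ : Measure ℝ) : ℝ :=
  ∫ D, compoundLoss δ D ∂sampleLaw n Gμ Gσ

end NEST

end

/-! The oracle rule is the posterior mean of `μ`, so it lies in `[-C, C]` (`abs_oracle_le`), while
clipping keeps the estimator in `[-T, T]`. The two squared losses therefore differ by at most `T +
3C` times the distance of the two rules, and this distance is split according to a threshold `τ` for
the true density `f_σ(X)`.

Where `f_σ(X) < τ` the distance is at most `2T`. This event is rare: on `|X| ≤ R` it has mass at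
most `2Rτ`, and Markov's inequality controls `|X| > R` (`tripleLaw_marginal_lt_le`). Where `f_σ(X) ≥
τ`, Tweedie's quotient is stable, and the distance is at most a multiple of `τ⁻²` times the errors
in the density and its derivative (`abs_nest_sub_le`). Since `C` and `T` grow slower than every
power of `n`, it suffices that the averaged estimation error is `O(n^{-ρ})` for some `ρ > 0`;
suitable powers of `n` for `τ` and `R` then finish the proof.

The estimation error is bounded with all standard deviations frozen, so that `X_j = μ_j + σ_j z_j`
are independent (`measurePreserving_sampleLaw`). Bias: smoothing a normal law with a Gaussian kernel
only changes its standard deviation, and the kernels are Lipschitz in that parameter, which leaves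
`h_x` plus the weighted mean of `|σ_i - σ_j|`, of order `h_σ log n` (`sum_weight_mul_abs_le`).
Variance: it is of order at most `h_x⁻³ ∑_j w_j²`, and `∑_j w_j²` is at most the self-weight of
observation `i`. The dependence caused by evaluating at `X_i` is removed by resampling the `i`-th
noise, again at the price of the self-weight (`integral_kernelError_self_le`). The self-weights add
up to `O(h_σ⁻¹)` for every configuration of the `σ_i` (`sum_weight_self_le`), so no regularity of
`G_σ` is needed, and the average variance is of order `n⁻¹ h_x⁻³ h_σ⁻¹`. This is where `3η_x + η_s <
1` enters. -/

noncomputable section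

namespace NEST

open ProbabilityTheory

/-! ### The Gaussian kernel and its derivative -/

/-- The derivative of the Gaussian kernel `phi h` at `z`. -/
def dphi (h z : ℝ) : ℝ := -z / h ^ 2 * phi h z

lemma one_le_sqrt_two_pi : 1 ≤ √(2 * Real.pi) := by
  rw [Real.one_le_sqrt]; linarith [Real.two_le_pi]

lemma phi_pos {h : ℝ} (hh : 0 < h) (z : ℝ) : 0 < phi h z := by
  have := one_le_sqrt_two_pi
  unfold phi; positivity

lemma phi_le_inv_mul_exp {h : ℝ} (hh : 0 < h) (z : ℝ) :
    phi h z ≤ 1 / h * Real.exp (-z ^ 2 / (2 * h ^ 2)) := by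
  unfold phi
  have := one_le_sqrt_two_pi
  gcongr
  nlinarith

lemma phi_le {h : ℝ} (hh : 0 < h) (z : ℝ) : phi h z ≤ 1 / h := by
  refine (phi_le_inv_mul_exp hh z).trans ?_
  refine mul_le_of_le_one_right (by positivity) ?_
  rw [Real.exp_le_one_iff, neg_div]
  simp only [Left.neg_nonpos_iff]; positivity

lemma hasDerivAt_phi (h z : ℝ) : HasDerivAt (phi h) (dphi h z) z := by
  rcases eq_or_ne h 0 with rfl | hh
  · have : phi 0 = fun _ => 0 := by ext; simp [phi]
    rw [this]; simpa [dphi, phi] using hasDerivAt_const z (0 : ℝ)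
  · have h1 : HasDerivAt (fun z : ℝ => -z ^ 2 / (2 * h ^ 2)) (-z / h ^ 2) z := by
      refine (((hasDerivAt_pow 2 z).neg).div_const (2 * h ^ 2)).congr_deriv ?_
      field_simp; norm_num
    refine ((h1.exp).const_mul (1 / (√(2 * Real.pi) * h))).congr_deriv ?_
    unfold dphi phi; ring

lemma measurable_phi : Measurable fun p : ℝ × ℝ => phi p.1 p.2 := by
  unfold phi; fun_prop

lemma measurable_dphi : Measurable fun p : ℝ × ℝ => dphi p.1 p.2 := by
  unfold dphi phi; fun_prop

lemma mul_exp_neg_le_one (t : ℝ) : t * Real.exp (-t) ≤ 1 := by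
  rw [Real.exp_neg, ← div_eq_mul_inv, div_le_one (Real.exp_pos _)]
  linarith [Real.add_one_le_exp t]

lemma sq_mul_phi_le {h : ℝ} (hh : 0 < h) (z : ℝ) : z ^ 2 / h ^ 2 * phi h z ≤ 2 / h := by
  have h1 := phi_le_inv_mul_exp hh z
  have h2 := mul_exp_neg_le_one (z ^ 2 / (2 * h ^ 2))
  calc _ ≤ z ^ 2 / h ^ 2 * (1 / h * Real.exp (-z ^ 2 / (2 * h ^ 2))) := by gcongr
    _ = 2 / h * (z ^ 2 / (2 * h ^ 2) * Real.exp (-(z ^ 2 / (2 * h ^ 2)))) := by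
      rw [neg_div]; ring
    _ ≤ 2 / h * 1 := by gcongr
    _ = _ := by ring

/-- Keeping one factor `phi` lets a second moment of `dphi` be integrated as a density. This costs
`h⁻³` in the variance, where the squared sup bound would cost `h⁻⁴`. -/
lemma dphi_sq_le {h : ℝ} (hh : 0 < h) (z : ℝ) : dphi h z ^ 2 ≤ 2 / h ^ 3 * phi h z := by
  have hp := phi_pos hh z
  calc dphi h z ^ 2 = 1 / h ^ 2 * phi h z * (z ^ 2 / h ^ 2 * phi h z) := by
        unfold dphi; ring
    _ ≤ 1 / h ^ 2 * phi h z * (2 / h) := by gcongr; exact sq_mul_phi_le hh z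
    _ = _ := by field_simp

lemma abs_dphi_le {h : ℝ} (hh : 0 < h) (z : ℝ) : |dphi h z| ≤ 2 / h ^ 2 := by
  refine abs_le_of_sq_le_sq ?_ (by positivity)
  calc dphi h z ^ 2 ≤ 2 / h ^ 3 * phi h z := dphi_sq_le hh z
    _ ≤ 2 / h ^ 3 * (1 / h) := by gcongr; exact phi_le hh z
    _ = 2 / h ^ 4 := by field_simp
    _ ≤ 4 / h ^ 4 := by gcongr; norm_num
    _ = _ := by ring

lemma abs_mul_phi_le {h : ℝ} (hh : 0 < h) (z : ℝ) : |z| * phi h z ≤ 2 := by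
  have h1 := abs_dphi_le hh z
  have hp := phi_pos hh z
  have : |dphi h z| = |z| * phi h z / h ^ 2 := by
    unfold dphi
    rw [abs_mul, abs_div, abs_neg, abs_of_pos hp, abs_of_pos (by positivity : 0 < h ^ 2)]
    ring
  rw [this] at h1
  exact (div_le_div_iff_of_pos_right (by positivity)).1 h1

/-- Needed for the derivative of `dphi` in `h`. With `t = |z| / h`, splitting the exponential into
two equal factors gives `t⁴ exp(-t²/2) ≤ 16`, and `t³ ≤ 1 + t⁴` adds the remaining `1`. -/
lemma abs_cube_mul_phi_le {h : ℝ} (hh : 0 < h) (z : ℝ) : |z| ^ 3 / h ^ 2 * phi h z ≤ 17 := by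
  have h1 := phi_le_inv_mul_exp hh z
  set t := |z| / h with ht
  have ht0 : 0 ≤ t := by positivity
  have e1 : -z ^ 2 / (2 * h ^ 2) = -(t ^ 2 / 4) + -(t ^ 2 / 4) := by
    rw [ht, div_pow, sq_abs]; ring
  have h2 := mul_exp_neg_le_one (t ^ 2 / 4)
  have h3 : 0 ≤ t ^ 2 / 4 * Real.exp (-(t ^ 2 / 4)) := by positivity
  have h4 : t ^ 4 * Real.exp (-(t ^ 2 / 4) + -(t ^ 2 / 4)) ≤ 16 := by
    rw [Real.exp_add]
    nlinarith
  have h5 : Real.exp (-(t ^ 2 / 4) + -(t ^ 2 / 4)) ≤ 1 := by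
    rw [Real.exp_le_one_iff]; nlinarith [sq_nonneg t]
  have h6 : t ^ 3 ≤ 1 + t ^ 4 := by
    nlinarith [sq_nonneg (t ^ 2 - t), sq_nonneg (t - 1), sq_nonneg (t ^ 2 - 1), sq_nonneg t]
  calc _ ≤ |z| ^ 3 / h ^ 2 * (1 / h * Real.exp (-z ^ 2 / (2 * h ^ 2))) := by gcongr
    _ = t ^ 3 * Real.exp (-(t ^ 2 / 4) + -(t ^ 2 / 4)) := by
      rw [e1, ht]; field_simp
    _ ≤ (1 + t ^ 4) * Real.exp (-(t ^ 2 / 4) + -(t ^ 2 / 4)) := by gcongr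
    _ ≤ _ := by linarith

lemma hasDerivAt_phi_left {h : ℝ} (hh : h ≠ 0) (z : ℝ) :
    HasDerivAt (fun h => phi h z) (phi h z * (z ^ 2 / h ^ 3 - 1 / h)) h := by
  have hs : √(2 * Real.pi) ≠ 0 := by linarith [one_le_sqrt_two_pi]
  have h1 : HasDerivAt (fun h : ℝ => -z ^ 2 / (2 * h ^ 2)) (z ^ 2 / h ^ 3) h := by
    refine ((hasDerivAt_const h (-z ^ 2)).div ((hasDerivAt_pow 2 h).const_mul 2)
      (by positivity)).congr_deriv ?_
    field_simp; ring
  have h2 : HasDerivAt (fun h : ℝ => 1 / (√(2 * Real.pi) * h))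
      (-(1 / (√(2 * Real.pi) * h)) / h) h := by
    refine ((hasDerivAt_const h (1 : ℝ)).div ((hasDerivAt_id h).const_mul _)
      (mul_ne_zero hs hh)).congr_deriv ?_
    simp only [id]; field_simp; norm_num
  refine (h2.mul h1.exp).congr_deriv ?_
  unfold phi; ring

/-- Controls the bias: the bound is uniform in `z`, by the mean value inequality on `[a, ∞)`. -/
lemma abs_phi_sub_le {a s t : ℝ} (ha : 0 < a) (hs : a ≤ s) (ht : a ≤ t) (z : ℝ) :
    |phi s z - phi t z| ≤ 3 / a ^ 2 * |s - t| := by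
  refine Convex.norm_image_sub_le_of_norm_hasDerivWithin_le (s := Set.Ici a)
    (f := fun h => phi h z)
    (fun h hh => (hasDerivAt_phi_left (ha.trans_le hh).ne' z).hasDerivWithinAt)
    (fun h hh => ?_) (convex_Ici a) ht hs
  have hh' : a ≤ h := hh
  have h0 : 0 < h := ha.trans_le hh'
  have hp := phi_pos h0 z
  have e : phi h z * (z ^ 2 / h ^ 3 - 1 / h)
      = 1 / h * (z ^ 2 / h ^ 2 * phi h z) - 1 / h * phi h z := by
    field_simp
  have h1 := sq_mul_phi_le h0 z
  have h2 := phi_le h0 z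
  have h3 : 1 / h * (z ^ 2 / h ^ 2 * phi h z) ≤ 1 / h * (2 / h) := by gcongr
  have h4 : 1 / h * phi h z ≤ 1 / h * (1 / h) := by gcongr
  have h5 : 0 ≤ 1 / h * (z ^ 2 / h ^ 2 * phi h z) := by positivity
  have h6 : 0 ≤ 1 / h * phi h z := by positivity
  have h7 : 3 / h ^ 2 ≤ 3 / a ^ 2 := by gcongr
  have h8 : 1 / h * (2 / h) + 1 / h * (1 / h) = 3 / h ^ 2 := by field_simp; norm_num
  rw [Real.norm_eq_abs, e, abs_le]
  constructor <;> linarith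

lemma hasDerivAt_dphi_left {h : ℝ} (hh : h ≠ 0) (z : ℝ) :
    HasDerivAt (fun h => dphi h z) (z * phi h z / h ^ 3 * (3 - z ^ 2 / h ^ 2)) h := by
  have h2 : HasDerivAt (fun h : ℝ => -z / h ^ 2) (2 * z / h ^ 3) h := by
    refine ((hasDerivAt_const h (-z)).div (hasDerivAt_pow 2 h) (by positivity)).congr_deriv ?_
    field_simp; ring
  refine (h2.mul (hasDerivAt_phi_left hh z)).congr_deriv ?_
  field_simp; ring

lemma abs_dphi_sub_le {a s t : ℝ} (ha : 0 < a) (hs : a ≤ s) (ht : a ≤ t) (z : ℝ) :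
    |dphi s z - dphi t z| ≤ 23 / a ^ 3 * |s - t| := by
  refine Convex.norm_image_sub_le_of_norm_hasDerivWithin_le (s := Set.Ici a)
    (f := fun h => dphi h z)
    (fun h hh => (hasDerivAt_dphi_left (ha.trans_le hh).ne' z).hasDerivWithinAt)
    (fun h hh => ?_) (convex_Ici a) ht hs
  have hh' : a ≤ h := hh
  have h0 : 0 < h := ha.trans_le hh'
  have hp := phi_pos h0 z
  have h1 := abs_mul_phi_le h0 z
  have h2 := abs_cube_mul_phi_le h0 z
  -- `23 = 3 · 2 + 17`, from `abs_mul_phi_le` and `abs_cube_mul_phi_le`.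
  have h7 : 23 / h ^ 3 ≤ 23 / a ^ 3 := by gcongr
  refine le_trans ?_ h7
  have h8 : |3 - z ^ 2 / h ^ 2| ≤ 3 + |z| ^ 2 / h ^ 2 := by
    rw [sq_abs, abs_le]
    have : 0 ≤ z ^ 2 / h ^ 2 := by positivity
    constructor <;> linarith
  rw [Real.norm_eq_abs, abs_mul, abs_div, abs_mul, abs_of_pos hp,
    abs_of_pos (by positivity : 0 < h ^ 3)]
  calc _ ≤ |z| * phi h z / h ^ 3 * (3 + |z| ^ 2 / h ^ 2) := by gcongr
    _ = (3 * (|z| * phi h z) + |z| ^ 3 / h ^ 2 * phi h z) / h ^ 3 := by ring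
    _ ≤ 23 / h ^ 3 := by gcongr; linarith

/-! ### Convolution with a normal law -/

lemma phi_eq_gaussianPDFReal {s : ℝ} (hs : 0 < s) (m x : ℝ) :
    phi s (x - m) = gaussianPDFReal m (s ^ 2).toNNReal x := by
  unfold phi gaussianPDFReal
  have : √(2 * Real.pi * s ^ 2) = √(2 * Real.pi) * s := by
    rw [Real.sqrt_mul (by positivity), Real.sqrt_sq hs.le]
  rw [Real.coe_toNNReal _ (sq_nonneg s), this, one_div]

lemma integral_phi {s : ℝ} (hs : 0 < s) (m : ℝ) : ∫ x, phi s (x - m) = 1 := by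
  simp_rw [phi_eq_gaussianPDFReal hs]
  refine integral_gaussianPDFReal_eq_one _ ?_
  simpa using hs.ne'

/-- Completing the square in `z` factors the integrand into the target value and a normal density in
`z` with standard deviation `h / r`. Hence smoothing has no bias beyond a change of standard
deviation. -/
lemma integral_phi_gaussianReal {h s : ℝ} (hh : 0 < h) (hs : 0 < s) (u : ℝ) :
    ∫ z, phi h (u - s * z) ∂(gaussianReal 0 1) = phi (√(s ^ 2 + h ^ 2)) u := by
  rw [integral_gaussianReal_eq_integral_smul (by norm_num)]
  set r := √(s ^ 2 + h ^ 2) with hr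
  have hr0 : 0 < r := by positivity
  have hr2 : r ^ 2 = s ^ 2 + h ^ 2 := Real.sq_sqrt (by positivity)
  have hq := one_le_sqrt_two_pi
  have key : ∀ z, gaussianPDFReal 0 1 z • phi h (u - s * z)
      = phi r u * phi (h / r) (z - s * u / r ^ 2) := by
    intro z
    have e1 : gaussianPDFReal 0 1 z = phi 1 z := by
      rw [← sub_zero z, phi_eq_gaussianPDFReal one_pos]; simp
    rw [e1, smul_eq_mul]
    unfold phi
    have : -z ^ 2 / (2 * 1 ^ 2) + -(u - s * z) ^ 2 / (2 * h ^ 2)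
        = -u ^ 2 / (2 * r ^ 2) + -(z - s * u / r ^ 2) ^ 2 / (2 * (h / r) ^ 2) := by
      field_simp
      simp only [hr2]; ring
    have e3 := congrArg Real.exp this
    rw [Real.exp_add, Real.exp_add] at e3
    calc _ = 1 / (√(2 * Real.pi) * √(2 * Real.pi) * h) *
          (Real.exp (-z ^ 2 / (2 * 1 ^ 2)) * Real.exp (-(u - s * z) ^ 2 / (2 * h ^ 2))) := by
          field_simp
      _ = _ := by rw [e3]; field_simp
  simp_rw [key]
  rw [integral_const_mul, integral_phi (by positivity), mul_one]

/-- Differentiate `integral_phi_gaussianReal` in `u` under the integral; derivatives are unique. -/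
lemma integral_dphi_gaussianReal {h s : ℝ} (hh : 0 < h) (hs : 0 < s) (u : ℝ) :
    ∫ z, dphi h (u - s * z) ∂(gaussianReal 0 1) = dphi (√(s ^ 2 + h ^ 2)) u := by
  have hm : ∀ x, Measurable fun z => phi h (x - s * z) := fun x =>
    measurable_phi.comp (measurable_const.prodMk (by fun_prop))
  have hm' : ∀ x, Measurable fun z => dphi h (x - s * z) := fun x =>
    measurable_dphi.comp (measurable_const.prodMk (by fun_prop))
  have h1 := hasDerivAt_integral_of_dominated_loc_of_deriv_le
    (μ := gaussianReal 0 1) (F := fun x z => phi h (x - s * z))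
    (F' := fun x z => dphi h (x - s * z)) (x₀ := u) (s := Set.univ) (bound := fun _ => 2 / h ^ 2)
    univ_mem (Eventually.of_forall fun x => (hm x).aestronglyMeasurable)
    (Integrable.of_bound (hm u).aestronglyMeasurable (1 / h) (ae_of_all _ fun z => by
      rw [Real.norm_eq_abs, abs_of_pos (phi_pos hh _)]; exact phi_le hh _))
    (hm' u).aestronglyMeasurable (ae_of_all _ fun z x _ => abs_dphi_le hh _)
    (integrable_const _) (ae_of_all _ fun z x _ => (hasDerivAt_phi h _).comp_sub_const x _)
  have h2 := h1.2
  simp_rw [integral_phi_gaussianReal hh hs] at h2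
  exact h2.unique (hasDerivAt_phi _ u)

/-! ### The marginal density and the oracle rule -/

/-- The derivative of the marginal density `marginal Gμ σ` at `x`. -/
def dmarginal (Gμ : Measure ℝ) (σ x : ℝ) : ℝ :=
  ∫ m, dphi σ (x - m) ∂Gμ

section Marginal

variable {G : Measure ℝ} [IsProbabilityMeasure G]

lemma integrable_phi_sub {σ : ℝ} (hσ : 0 < σ) (x : ℝ) : Integrable (fun m => phi σ (x - m)) G := by
  refine Integrable.of_bound ?_ (1 / σ) (ae_of_all _ fun z => by
      rw [Real.norm_eq_abs, abs_of_pos (phi_pos hσ _)]; exact phi_le hσ _)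
  exact (measurable_phi.comp (measurable_const.prodMk (by fun_prop))).aestronglyMeasurable

lemma integrable_dphi_sub {σ : ℝ} (hσ : 0 < σ) (x : ℝ) :
    Integrable (fun m => dphi σ (x - m)) G := by
  refine Integrable.of_bound ?_ (2 / σ ^ 2) (ae_of_all _ fun z => abs_dphi_le hσ _)
  exact (measurable_dphi.comp (measurable_const.prodMk (by fun_prop))).aestronglyMeasurable

lemma hasDerivAt_marginal {σ : ℝ} (hσ : 0 < σ) (x : ℝ) :
    HasDerivAt (marginal G σ) (dmarginal G σ x) x := by
  refine (hasDerivAt_integral_of_dominated_loc_of_deriv_le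
    (μ := G) (F := fun x m => phi σ (x - m))
    (F' := fun x m => dphi σ (x - m)) (x₀ := x) (s := Set.univ) (bound := fun _ => 2 / σ ^ 2)
    univ_mem (Eventually.of_forall fun x => (integrable_phi_sub hσ x).aestronglyMeasurable)
    (integrable_phi_sub hσ x) (integrable_dphi_sub hσ x).aestronglyMeasurable
    (ae_of_all _ fun z x _ => abs_dphi_le hσ _)
    (integrable_const _) (ae_of_all _ fun z x _ => (hasDerivAt_phi σ _).comp_sub_const x _)).2

lemma marginal_pos {σ : ℝ} (hσ : 0 < σ) (x : ℝ) : 0 < marginal G σ x := by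
  refine (integral_pos_iff_support_of_nonneg (fun m => (phi_pos hσ _).le)
    (integrable_phi_sub hσ x)).2 ?_
  have : Function.support (fun m => phi σ (x - m)) = Set.univ := by
    ext m; simpa using (phi_pos hσ _).ne'
  rw [this]; simp

lemma marginal_le {σ : ℝ} (hσ : 0 < σ) (x : ℝ) : marginal G σ x ≤ 1 / σ := by
  have := integral_mono (integrable_phi_sub (G := G) hσ x) (integrable_const (1 / σ))
    (fun m => phi_le hσ _)
  simpa [marginal] using this

lemma abs_dmarginal_le {σ : ℝ} (hσ : 0 < σ) (x : ℝ) : |dmarginal G σ x| ≤ 2 / σ ^ 2 := by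
  have := norm_integral_le_of_norm_le_const (μ := G) (f := fun m => dphi σ (x - m))
    (C := 2 / σ ^ 2) (ae_of_all _ fun m => abs_dphi_le hσ _)
  simpa [dmarginal] using this

lemma measurable_marginal : Measurable fun p : ℝ × ℝ => marginal G p.1 p.2 := by
  have : StronglyMeasurable fun q : (ℝ × ℝ) × ℝ => phi q.1.1 (q.1.2 - q.2) :=
    (measurable_phi.comp ((by fun_prop : Measurable fun q : (ℝ × ℝ) × ℝ =>
      (q.1.1, q.1.2 - q.2)))).stronglyMeasurable
  exact (this.integral_prod_right (ν := G)).measurable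

lemma measurable_dmarginal : Measurable fun p : ℝ × ℝ => dmarginal G p.1 p.2 := by
  have : StronglyMeasurable fun q : (ℝ × ℝ) × ℝ => dphi q.1.1 (q.1.2 - q.2) :=
    (measurable_dphi.comp ((by fun_prop : Measurable fun q : (ℝ × ℝ) × ℝ =>
      (q.1.1, q.1.2 - q.2)))).stronglyMeasurable
  exact (this.integral_prod_right (ν := G)).measurable

lemma oracle_eq {σ : ℝ} (hσ : 0 < σ) (x : ℝ) :
    oracle G x σ = x + σ ^ 2 * (dmarginal G σ x / marginal G σ x) := by
  rw [oracle, (hasDerivAt_marginal hσ x).deriv]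

/-- Tweedie's formula: multiplied by the marginal density, the oracle rule is `∫ m φ_σ(x - m) dG`,
so it is a weighted mean of values in `[-C, C]`. -/
lemma abs_oracle_le {σ C : ℝ} (hσ : 0 < σ) (hC : ∀ᵐ m ∂G, |m| ≤ C) (x : ℝ) :
    |oracle G x σ| ≤ C := by
  have hp := marginal_pos (G := G) hσ x
  have h1 : oracle G x σ * marginal G σ x = ∫ m, m * phi σ (x - m) ∂G := by
    rw [oracle_eq hσ]
    have : (x + σ ^ 2 * (dmarginal G σ x / marginal G σ x)) * marginal G σ x
        = x * marginal G σ x + σ ^ 2 * dmarginal G σ x := by field_simp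
    rw [this, marginal, dmarginal, ← integral_const_mul, ← integral_const_mul, ← integral_add
      ((integrable_phi_sub hσ x).const_mul _) ((integrable_dphi_sub hσ x).const_mul _)]
    congr with m
    unfold dphi; field_simp; ring
  have h2 : |∫ m, m * phi σ (x - m) ∂G| ≤ C * marginal G σ x := by
    rw [marginal, ← integral_const_mul]
    rw [← Real.norm_eq_abs]
    refine norm_integral_le_of_norm_le ((integrable_phi_sub (G := G) hσ x).const_mul _) ?_
    filter_upwards [hC] with m hm
    rw [norm_mul, Real.norm_eq_abs, Real.norm_eq_abs, abs_of_pos (phi_pos hσ _)]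
    exact mul_le_mul_of_nonneg_right hm (phi_pos hσ _).le
  rw [← h1, abs_mul, abs_of_pos hp] at h2
  exact le_of_mul_le_mul_right h2 hp

end Marginal

/-! ### The weights -/

section Weight

variable {n : ℕ} {hs : ℝ} {s : Fin n → ℝ}

lemma weight_eq (hs0 : 0 < hs) (σ : ℝ) (j : Fin n) :
    weight hs s σ j = Real.exp (-(σ - s j) ^ 2 / (2 * hs ^ 2))
      / ∑ k, Real.exp (-(σ - s k) ^ 2 / (2 * hs ^ 2)) := by
  have := one_le_sqrt_two_pi
  unfold weight phi
  rw [← Finset.mul_sum, mul_div_mul_left _ _ (by positivity)]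

lemma one_le_sum_exp (i : Fin n) : 1 ≤ ∑ k, Real.exp (-(s i - s k) ^ 2 / (2 * hs ^ 2)) := by
  have := Finset.single_le_sum (f := fun k => Real.exp (-(s i - s k) ^ 2 / (2 * hs ^ 2)))
    (fun k _ => (Real.exp_pos _).le) (Finset.mem_univ i)
  simpa using this

lemma weight_nonneg (hs0 : 0 < hs) (σ : ℝ) (j : Fin n) : 0 ≤ weight hs s σ j := by
  rw [weight_eq hs0]; positivity

lemma weight_self_eq (hs0 : 0 < hs) (i : Fin n) :
    weight hs s (s i) i = 1 / ∑ k, Real.exp (-(s i - s k) ^ 2 / (2 * hs ^ 2)) := by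
  rw [weight_eq hs0]; simp

lemma weight_le_weight_self (hs0 : 0 < hs) (i j : Fin n) :
    weight hs s (s i) j ≤ weight hs s (s i) i := by
  have := one_le_sum_exp (hs := hs) (s := s) i
  rw [weight_self_eq hs0, weight_eq hs0]
  gcongr
  rw [Real.exp_le_one_iff, neg_div]
  simp only [Left.neg_nonpos_iff]; positivity

lemma sum_weight (hs0 : 0 < hs) (i : Fin n) : ∑ j, weight hs s (s i) j = 1 := by
  have := one_le_sum_exp (hs := hs) (s := s) i
  simp_rw [weight_eq hs0]
  rw [← Finset.sum_div, div_self (by linarith)]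

/-- The self-weight is the largest weight and the weights sum to one. -/
lemma sum_weight_sq_le (hs0 : 0 < hs) (i : Fin n) :
    ∑ j, weight hs s (s i) j ^ 2 ≤ weight hs s (s i) i := by
  calc _ ≤ ∑ j, weight hs s (s i) j * weight hs s (s i) i := by
        refine Finset.sum_le_sum fun j _ => ?_
        rw [sq]
        exact mul_le_mul_of_nonneg_left (weight_le_weight_self hs0 i j) (weight_nonneg hs0 _ _)
    _ = _ := by rw [← Finset.sum_mul, sum_weight hs0, one_mul]

/-- `mul_exp_neg_le_one` at `y - L`. With `L = log n` the additive error is `1 / n`, which stays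
bounded when summed over `n` observations. -/
lemma mul_exp_neg_le (y L : ℝ) : y * Real.exp (-y) ≤ L * Real.exp (-y) + Real.exp (-L) := by
  have h := mul_exp_neg_le_one (y - L)
  have e : Real.exp (-(y - L)) * Real.exp (-L) = Real.exp (-y) := by
    rw [← Real.exp_add]; ring_nf
  have := mul_le_mul_of_nonneg_right h (Real.exp_pos (-L)).le
  rw [mul_assoc, e] at this
  linarith

/-- Holds for every configuration of `s`: in units of `2 * hs ^ 2`, squared distances cost a factor
`log n` plus an error `1 / n` each, and the normalizing sum is at least the own term `1`. -/
lemma sum_weight_mul_sq_le (hs0 : 0 < hs) (i : Fin n) :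
    ∑ j, weight hs s (s i) j * (s i - s j) ^ 2 ≤ 2 * hs ^ 2 * (Real.log n + 1) := by
  have hn : (0 : ℝ) < n := by exact_mod_cast i.pos
  set S := ∑ k, Real.exp (-(s i - s k) ^ 2 / (2 * hs ^ 2)) with hS
  have h1 : 1 ≤ S := one_le_sum_exp i
  have h2 : ∀ j, weight hs s (s i) j * (s i - s j) ^ 2 ≤ 2 * hs ^ 2 / S *
      (Real.log n * Real.exp (-(s i - s j) ^ 2 / (2 * hs ^ 2)) + 1 / n) := by
    intro j
    have h := mul_exp_neg_le ((s i - s j) ^ 2 / (2 * hs ^ 2)) (Real.log n)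
    rw [Real.exp_neg (Real.log n), Real.exp_log hn, ← neg_div, ← one_div] at h
    rw [weight_eq hs0, ← hS]
    calc _ = 2 * hs ^ 2 / S * ((s i - s j) ^ 2 / (2 * hs ^ 2) *
          Real.exp (-(s i - s j) ^ 2 / (2 * hs ^ 2))) := by field_simp
      _ ≤ _ := by gcongr
  refine (Finset.sum_le_sum fun j _ => h2 j).trans ?_
  rw [← Finset.mul_sum, Finset.sum_add_distrib, ← Finset.mul_sum, ← hS]
  have h3 : ∑ _j : Fin n, 1 / (n : ℝ) = 1 := by simp [hn.ne']
  rw [h3]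
  calc _ = 2 * hs ^ 2 * (Real.log n + 1 / S) := by field_simp
    _ ≤ 2 * hs ^ 2 * (Real.log n + 1) := by
      gcongr; rw [div_le_one (by linarith)]; exact h1

/-- From the squared distances by `|d| ≤ d² / (2 hs) + hs / 2`. -/
lemma sum_weight_mul_abs_le (hs0 : 0 < hs) (i : Fin n) :
    ∑ j, weight hs s (s i) j * |s i - s j| ≤ hs * (Real.log n + 2) := by
  have h1 : ∀ j, weight hs s (s i) j * |s i - s j| ≤
      weight hs s (s i) j * (s i - s j) ^ 2 * (1 / (2 * hs)) + weight hs s (s i) j * (hs / 2) := by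
    intro j
    rw [mul_assoc, ← mul_add]
    refine mul_le_mul_of_nonneg_left ?_ (weight_nonneg hs0 _ _)
    rw [← sq_abs]
    have : |s i - s j| ^ 2 * (1 / (2 * hs)) + hs / 2 - |s i - s j|
      = (|s i - s j| - hs) ^ 2 / (2 * hs) := by field_simp; ring
    have h2 : 0 ≤ (|s i - s j| - hs) ^ 2 / (2 * hs) := by positivity
    linarith
  refine (Finset.sum_le_sum fun j _ => h1 j).trans ?_
  rw [Finset.sum_add_distrib, ← Finset.sum_mul, ← Finset.sum_mul, sum_weight hs0, one_mul]
  have h3 := sum_weight_mul_sq_le (s := s) hs0 i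
  calc _ ≤ 2 * hs ^ 2 * (Real.log n + 1) * (1 / (2 * hs)) + hs / 2 := by gcongr
    _ = hs * (Real.log n + 1) + hs / 2 := by field_simp
    _ ≤ _ := by linarith

/-- The self-weights add up to at most a multiple of the number of bins of width `hs` that are
needed to cover the range of `s`. -/
lemma sum_weight_self_le (hs0 : 0 < hs) {a b : ℝ} (hsab : ∀ i, a ≤ s i ∧ s i ≤ b) (hab : a ≤ b) :
    ∑ i, weight hs s (s i) i ≤ 2 * ((b - a) / hs + 1) := by
  let bin : Fin n → ℕ := fun i => ⌊(s i - a) / hs⌋₊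
  have hbin : ∀ i j, bin i = bin j → |s i - s j| ≤ hs := by
    intro i j hij
    have h0 : ∀ i, 0 ≤ (s i - a) / hs := fun i =>
      div_nonneg (by linarith [(hsab i).1]) hs0.le
    have h1 : ∀ i, hs * bin i ≤ s i - a ∧ s i - a < hs * bin i + hs := by
      intro i
      have h2 : (bin i : ℝ) ≤ (s i - a) / hs := Nat.floor_le (h0 i)
      have h3 : (s i - a) / hs < bin i + 1 := Nat.lt_floor_add_one _
      rw [le_div_iff₀ hs0] at h2
      rw [div_lt_iff₀ hs0] at h3
      constructor <;> linarith
    have hi := h1 i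
    have hj := h1 j
    rw [hij] at hi
    rw [abs_le]; constructor <;> linarith [hi.1, hi.2, hj.1, hj.2]
  -- Points of one bin are within `hs`, so each contributes at least `exp (-1/2) ≥ 1/2` to the
  -- normalizing sum; a self-weight is thus at most twice the reciprocal of the bin count.
  have hhalf : (1 : ℝ) / 2 ≤ Real.exp (-1 / 2) := by
    have := Real.add_one_le_exp (-1 / 2 : ℝ); linarith
  have hw : ∀ i, weight hs s (s i) i
      ≤ 2 * (1 / ((Finset.univ.filter fun j => bin j = bin i).card : ℝ)) := by
    intro i
    have hc : (0 : ℝ) < (Finset.univ.filter fun j => bin j = bin i).card := by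
      exact_mod_cast Finset.card_pos.2 ⟨i, by simp⟩
    have hS : 1 / 2 * ((Finset.univ.filter fun j => bin j = bin i).card : ℝ)
        ≤ ∑ k, Real.exp (-(s i - s k) ^ 2 / (2 * hs ^ 2)) := by
      calc _ = ∑ _k ∈ Finset.univ.filter (fun j => bin j = bin i), (1 / 2 : ℝ) := by
            simp [mul_comm]
        _ ≤ ∑ k ∈ Finset.univ.filter (fun j => bin j = bin i),
            Real.exp (-(s i - s k) ^ 2 / (2 * hs ^ 2)) := by
          refine Finset.sum_le_sum fun k hk => hhalf.trans (Real.exp_le_exp.2 ?_)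
          have h1 := hbin i k (by simpa using (Finset.mem_filter.1 hk).2.symm)
          have h2 : (s i - s k) ^ 2 ≤ hs ^ 2 := by
            rw [← sq_abs]; gcongr
          rw [div_le_div_iff₀ (by positivity) (by positivity)]
          nlinarith
        _ ≤ _ := Finset.sum_le_sum_of_subset_of_nonneg (Finset.subset_univ _)
          fun k _ _ => (Real.exp_pos _).le
    rw [weight_self_eq hs0]
    calc _ ≤ 1 / (1 / 2 * ((Finset.univ.filter fun j => bin j = bin i).card : ℝ)) := by gcongr
      _ = _ := by field_simp
  refine (Finset.sum_le_sum fun i _ => hw i).trans ?_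
  rw [← Finset.mul_sum]
  gcongr
  have hmap : ∀ i ∈ (Finset.univ : Finset (Fin n)), bin i ∈ Finset.range (⌊(b - a) / hs⌋₊ + 1) := by
    intro i _
    rw [Finset.mem_range, Nat.lt_succ_iff]
    exact Nat.floor_le_floor (by have := (hsab i).2; gcongr)
  rw [← Finset.sum_fiberwise_of_maps_to hmap]
  -- Over one bin the reciprocals of its count add up to `1`, or to `0` if the bin is empty.
  calc _ ≤ ∑ _c ∈ Finset.range (⌊(b - a) / hs⌋₊ + 1), (1 : ℝ) := by
        refine Finset.sum_le_sum fun c _ => ?_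
        rw [Finset.sum_congr rfl (g := fun _ =>
          1 / ((Finset.univ.filter fun j => bin j = c).card : ℝ))
          (fun i hi => by rw [(Finset.mem_filter.1 hi).2])]
        rw [Finset.sum_const, nsmul_eq_mul, mul_one_div]
        exact div_self_le_one _
    _ = ⌊(b - a) / hs⌋₊ + 1 := by simp
    _ ≤ _ := by
      gcongr; exact Nat.floor_le (div_nonneg (by linarith) hs0.le)

end Weight

/-! ### The law of the sample -/

/-- The triple `(x, μ, σ)` generated by the standardized noise `z` and mean `μ`, paired as
`ω = (z, μ)`, and the standard deviation `σ`. -/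
def mkTriple (ω : ℝ × ℝ) (σ : ℝ) : ℝ × ℝ × ℝ := (ω.2 + σ * ω.1, ω.2, σ)

lemma measurable_mkTriple : Measurable fun q : (ℝ × ℝ) × ℝ => mkTriple q.1 q.2 := by
  unfold mkTriple; fun_prop

/-- The law of standardized noise and mean. -/
def noiseLaw (Gμ : Measure ℝ) : Measure (ℝ × ℝ) := (gaussianReal 0 1).prod Gμ

instance (Gμ : Measure ℝ) [IsProbabilityMeasure Gμ] : IsProbabilityMeasure (noiseLaw Gμ) := by
  unfold noiseLaw; infer_instance

lemma gaussianReal_map_affine {σ : ℝ} (m : ℝ) :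
    (gaussianReal 0 1).map (fun z => m + σ * z) = gaussianReal m (σ ^ 2).toNNReal := by
  have h1 := gaussianReal_map_const_mul (μ := 0) (v := 1) σ
  have h2 : (gaussianReal 0 1).map (fun z => m + σ * z)
      = ((gaussianReal 0 1).map (σ * ·)).map (m + ·) := by
    rw [Measure.map_map (by fun_prop) (by fun_prop)]; rfl
  rw [h2, h1, gaussianReal_map_const_add]
  congr 1
  · simp
  · rw [mul_one]; ext; simp [Real.coe_toNNReal _ (sq_nonneg σ)]

lemma lintegral_phi_indicator {σ : ℝ} (hσ : 0 < σ) (m : ℝ) {A : Set ℝ} (hA : MeasurableSet A) :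
    ∫⁻ x, A.indicator (fun x => ENNReal.ofReal (phi σ (x - m))) x
      = gaussianReal 0 1 ((fun z => m + σ * z) ⁻¹' A) := by
  rw [← Measure.map_apply (by fun_prop) hA, gaussianReal_map_affine,
    gaussianReal_apply _ (by simpa using hσ.ne'), lintegral_indicator hA]
  simp_rw [phi_eq_gaussianPDFReal hσ, gaussianPDF]

/-- The representation `X = μ + σ z`. It makes the noise pair `(z, μ)` independent of `σ`, so
conditioning on the standard deviations becomes Fubini. `phi` is a probability density only for
positive `σ`. -/
lemma tripleLaw_eq_map (Gμ Gσ : Measure ℝ) [IsProbabilityMeasure Gμ] [IsProbabilityMeasure Gσ]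
    (hσ : ∀ᵐ s ∂Gσ, 0 < s) :
    tripleLaw Gμ Gσ = ((noiseLaw Gμ).prod Gσ).map fun q => mkTriple q.1 q.2 := by
  have hm : Measurable fun p : ℝ × ℝ × ℝ => ENNReal.ofReal (phi p.2.2 (p.1 - p.2.1)) :=
    (measurable_phi.comp (by fun_prop : Measurable fun p : ℝ × ℝ × ℝ =>
      (p.2.2, p.1 - p.2.1))).ennreal_ofReal
  ext S hS
  rw [Measure.map_apply measurable_mkTriple hS, Measure.prod_apply_symm
    (measurable_mkTriple hS), tripleLaw, withDensity_apply _ hS, ← lintegral_indicator hS,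
    lintegral_prod_symm' _ (hm.indicator hS), lintegral_prod_symm']
  swap
  · exact (hm.indicator hS).lintegral_prod_left'
  refine lintegral_congr_ae ?_
  filter_upwards [hσ] with s hs
  have hS' : MeasurableSet ((fun x : ℝ × ℝ => (x, s)) ⁻¹' ((fun q : (ℝ × ℝ) × ℝ =>
      mkTriple q.1 q.2) ⁻¹' S)) := (by fun_prop : Measurable fun x : ℝ × ℝ => (x, s))
    (measurable_mkTriple hS)
  rw [noiseLaw, Measure.prod_apply_symm hS']
  refine lintegral_congr fun m => ?_
  have hA : MeasurableSet {x : ℝ | (x, m, s) ∈ S} :=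
    (by fun_prop : Measurable fun x : ℝ => (x, m, s)) hS
  exact lintegral_phi_indicator hs m hA

lemma isProbabilityMeasure_tripleLaw (Gμ Gσ : Measure ℝ) [IsProbabilityMeasure Gμ]
    [IsProbabilityMeasure Gσ] (hσ : ∀ᵐ s ∂Gσ, 0 < s) : IsProbabilityMeasure (tripleLaw Gμ Gσ) := by
  rw [tripleLaw_eq_map Gμ Gσ hσ]
  exact Measure.isProbabilityMeasure_map measurable_mkTriple.aemeasurable

/-- Separates all noises from all deviations, so that the deviations, and with them the weights, can
be frozen while the noises stay i.i.d. -/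
lemma measurePreserving_sampleLaw (n : ℕ) (Gμ Gσ : Measure ℝ) [IsProbabilityMeasure Gμ]
    [IsProbabilityMeasure Gσ] (hσ : ∀ᵐ s ∂Gσ, 0 < s) :
    MeasurePreserving (fun (q : (Fin n → ℝ × ℝ) × (Fin n → ℝ)) j => mkTriple (q.1 j) (q.2 j))
      ((Measure.pi fun _ => noiseLaw Gμ).prod (Measure.pi fun _ => Gσ))
      (sampleLaw n Gμ Gσ) := by
  have h1 := (measurePreserving_arrowProdEquivProdArrow (ℝ × ℝ) ℝ (Fin n)
    (fun _ => noiseLaw Gμ) (fun _ => Gσ)).symm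
  have := isProbabilityMeasure_tripleLaw Gμ Gσ hσ
  have : ∀ i : Fin n, SigmaFinite (((noiseLaw Gμ).prod Gσ).map fun q => mkTriple q.1 q.2) := by
    intro i; rw [← tripleLaw_eq_map Gμ Gσ hσ]; infer_instance
  have h2 : MeasurePreserving (fun (x : Fin n → (ℝ × ℝ) × ℝ) j => mkTriple (x j).1 (x j).2)
      (Measure.pi fun _ => (noiseLaw Gμ).prod Gσ) (sampleLaw n Gμ Gσ) := by
    refine ⟨?_, ?_⟩
    · exact measurable_pi_lambda _ fun j => measurable_mkTriple.comp (measurable_pi_apply j)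
    · rw [sampleLaw, Measure.pi_map_pi (f := fun _ (q : (ℝ × ℝ) × ℝ) => mkTriple q.1 q.2)
        (fun i => measurable_mkTriple.aemeasurable), tripleLaw_eq_map Gμ Gσ hσ]
  exact h2.comp h1

/-- Resampling one coordinate of an i.i.d. sample leaves its law unchanged. -/
lemma measurePreserving_update {ι α : Type*} [Fintype ι] [DecidableEq ι] [MeasurableSpace α]
    (μ : Measure α) [IsProbabilityMeasure μ] (i : ι) :
    MeasurePreserving (fun p : α × (ι → α) => Function.update p.2 i p.1)
      (μ.prod (Measure.pi fun _ => μ)) (Measure.pi fun _ => μ) := by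
  have hm : Measurable (fun p : α × (ι → α) => Function.update p.2 i p.1) := by
    refine measurable_pi_lambda _ fun j => ?_
    by_cases h : j = i
    · subst h; simpa using measurable_fst
    · simp only [Function.update_of_ne h]; fun_prop
  refine ⟨hm, (Measure.pi_eq fun S hS => ?_).symm⟩
  rw [Measure.map_apply hm (MeasurableSet.univ_pi hS)]
  -- The `i`-th side of the box constrains only the fresh coordinate; the overwritten one is free.
  have : (fun p : α × (ι → α) => Function.update p.2 i p.1) ⁻¹' Set.univ.pi S
      = S i ×ˢ Set.univ.pi (Function.update S i Set.univ) := by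
    ext p
    simp only [Set.mem_preimage, Set.mem_univ_pi, Set.mem_prod]
    constructor
    · intro h
      refine ⟨by simpa using h i, fun j => ?_⟩
      by_cases hj : j = i
      · subst hj; simp
      · simpa [hj] using h j
    · rintro ⟨h1, h2⟩ j
      by_cases hj : j = i
      · subst hj; simpa using h1
      · simpa [hj] using h2 j
  rw [this, Measure.prod_prod, Measure.pi_pi, ← Finset.mul_prod_erase _ _ (Finset.mem_univ i),
    ← Finset.mul_prod_erase (Finset.univ) (fun j => μ (S j)) (Finset.mem_univ i)]
  simp only [Function.update_self, measure_univ, one_mul]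
  congr 1
  exact Finset.prod_congr rfl fun j hj => by rw [Function.update_of_ne (Finset.ne_of_mem_erase hj)]

/-! ### Error of a weighted kernel estimate for fixed standard deviations -/

lemma integrable_of_measurable_of_abs_le {α : Type*} [MeasurableSpace α] {P : Measure α}
    [IsFiniteMeasure P] {f : α → ℝ} (hf : Measurable f) {B : ℝ} (hB : ∀ x, |f x| ≤ B) :
    Integrable f P :=
  Integrable.of_bound hf.aestronglyMeasurable B (ae_of_all _ hB)

lemma integral_le_of_le {α : Type*} [MeasurableSpace α] {P : Measure α} [IsProbabilityMeasure P]
    {f : α → ℝ} (hf : Integrable f P) {c : ℝ} (h : ∀ᵐ x ∂P, f x ≤ c) : ∫ x, f x ∂P ≤ c := by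
  have := integral_mono_ae hf (integrable_const c) h
  simpa using this

/-- The mean absolute deviation of a weighted sum of independent variables. -/
lemma integral_abs_weighted_sum_sub_le {α : Type*} [MeasurableSpace α] {n : ℕ} (P : Measure α)
    [IsProbabilityMeasure P] {Y : Fin n → α → ℝ} (hY : ∀ j, Measurable (Y j)) {B : ℝ}
    (hB : ∀ j ω, |Y j ω| ≤ B) (w : Fin n → ℝ) {v : ℝ} (hv : ∀ j, ∫ ω, Y j ω ^ 2 ∂P ≤ v)
    {lam : ℝ} (hlam : 0 < lam) :
    ∫ ω, |∑ j, w j * Y j (ω j) - ∑ j, w j * ∫ ω', Y j ω' ∂P| ∂(Measure.pi fun _ : Fin n => P)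
      ≤ lam * v * ∑ j, w j ^ 2 + 1 / lam := by
  set Q := Measure.pi fun _ : Fin n => P
  have hmem : ∀ j, MemLp (fun ω => w j * Y j ω) 2 P := fun j =>
    MemLp.of_bound ((hY j).const_mul _).aestronglyMeasurable (|w j| * B) (ae_of_all _ fun ω => by
      rw [Real.norm_eq_abs, abs_mul]; exact mul_le_mul_of_nonneg_left (hB j ω) (abs_nonneg _))
  have hvar := variance_sum_pi (μ := fun _ : Fin n => P) hmem
  have hYm : ∀ j, Measurable fun ω : Fin n → α => w j * Y j (ω j) := fun j =>
    ((hY j).comp (measurable_pi_apply j)).const_mul _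
  have hYi : ∀ j, Integrable (fun ω : Fin n → α => w j * Y j (ω j)) Q := fun j =>
    integrable_of_measurable_of_abs_le (hYm j) (B := |w j| * B) fun ω => by
      rw [abs_mul]; exact mul_le_mul_of_nonneg_left (hB j _) (abs_nonneg _)
  have hsum : (∑ j, fun ω : Fin n → α => w j * Y j (ω j)) = fun ω => ∑ j, w j * Y j (ω j) := by
    ext ω; simp
  have hmean : ∫ ω, ∑ j, w j * Y j (ω j) ∂Q = ∑ j, w j * ∫ ω', Y j ω' ∂P := by
    rw [integral_finsetSum _ fun j _ => hYi j]
    refine Finset.sum_congr rfl fun j _ => ?_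
    rw [integral_const_mul, ← (measurePreserving_eval (fun _ : Fin n => P) j).map_eq,
      integral_map (measurable_pi_apply j).aemeasurable (hY j).aestronglyMeasurable]
  rw [hsum, variance_eq_integral (Finset.measurable_sum _ fun j _ => hYm j).aemeasurable] at hvar
  change ∫ ω, (∑ j, w j * Y j (ω j) - ∫ ω, ∑ j, w j * Y j (ω j) ∂Q) ^ 2 ∂Q = _ at hvar
  rw [hmean] at hvar
  set e := ∑ j, w j * ∫ ω', Y j ω' ∂P
  have hle : ∑ j, Var[fun ω => w j * Y j ω; P] ≤ v * ∑ j, w j ^ 2 := by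
    rw [Finset.mul_sum]
    refine Finset.sum_le_sum fun j _ => ?_
    rw [variance_const_mul, mul_comm v]
    refine mul_le_mul_of_nonneg_left ?_ (sq_nonneg _)
    exact (variance_le_expectation_sq (hY j).aestronglyMeasurable).trans (hv j)
  have hb : ∀ ω : Fin n → α, |∑ j, w j * Y j (ω j) - e| ≤ ∑ j, |w j| * B + |e| := fun ω => by
    refine (abs_sub _ _).trans (add_le_add_left ?_ _)
    refine (Finset.abs_sum_le_sum_abs _ _).trans (Finset.sum_le_sum fun j _ => ?_)
    rw [abs_mul]; exact mul_le_mul_of_nonneg_left (hB j _) (abs_nonneg _)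
  have hm : Measurable fun ω : Fin n → α => ∑ j, w j * Y j (ω j) - e :=
    (Finset.measurable_sum _ fun j _ => hYm j).sub_const _
  have hi2 : Integrable (fun ω : Fin n → α => (∑ j, w j * Y j (ω j) - e) ^ 2) Q := by
    refine integrable_of_measurable_of_abs_le (hm.pow_const 2)
      (B := (∑ j, |w j| * B + |e|) ^ 2) fun ω => ?_
    rw [abs_pow]; exact pow_le_pow_left₀ (abs_nonneg _) (hb ω) 2
  -- `t ≤ lam * t ^ 2 + 1 / lam` replaces the square root of the variance by a linear bound, so that
  -- self-weights can later be summed over `i`.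
  calc _ ≤ ∫ ω, (lam * (∑ j, w j * Y j (ω j) - e) ^ 2 + 1 / lam) ∂Q := by
        refine integral_mono (integrable_of_measurable_of_abs_le hm.norm
          (B := ∑ j, |w j| * B + |e|) fun ω => ?_)
          ((hi2.const_mul lam).add (integrable_const _)) fun ω => ?_
        · rw [abs_abs]; exact hb ω
        · change |∑ j, w j * Y j (ω j) - e| ≤ lam * (∑ j, w j * Y j (ω j) - e) ^ 2 + 1 / lam
          rw [← sq_abs]
          set t := |∑ j, w j * Y j (ω j) - e|
          have : lam * t ^ 2 + 1 / lam - t = ((lam * t - 1 / 2) ^ 2 + 3 / 4) / lam := by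
            field_simp; ring
          have h2 : 0 ≤ ((lam * t - 1 / 2) ^ 2 + 3 / 4) / lam := by positivity
          linarith
    _ = lam * ∑ j, Var[fun ω => w j * Y j ω; P] + 1 / lam := by
        rw [integral_add (hi2.const_mul lam) (integrable_const _), integral_const_mul, hvar]
        simp
    _ ≤ lam * (v * ∑ j, w j ^ 2) + 1 / lam := by gcongr
    _ = _ := by ring

lemma integrable_noiseLaw_of_abs_le {G : Measure ℝ} [IsProbabilityMeasure G] {k : ℝ → ℝ}
    (hk : Measurable k) {B : ℝ} (hB : ∀ z, |k z| ≤ B) (x σ : ℝ) :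
    Integrable (fun ω : ℝ × ℝ => k (x - (mkTriple ω σ).1)) (noiseLaw G) :=
  integrable_of_measurable_of_abs_le (hk.comp (by unfold mkTriple; fun_prop)) fun _ => hB _

lemma integral_noiseLaw {G : Measure ℝ} [IsProbabilityMeasure G] {k : ℝ → ℝ}
    (hk : Measurable k) {B : ℝ} (hB : ∀ z, |k z| ≤ B) (x σ : ℝ) :
    ∫ ω, k (x - (mkTriple ω σ).1) ∂(noiseLaw G)
      = ∫ m, ∫ z, k (x - m - σ * z) ∂(gaussianReal 0 1) ∂G := by
  have := integrable_noiseLaw_of_abs_le (G := G) hk hB x σ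
  rw [noiseLaw] at this ⊢
  rw [integral_prod_symm _ this]
  simp only [mkTriple, sub_sub]

lemma measurable_kernel_left {k : ℝ → ℝ → ℝ} (hk : Measurable fun p : ℝ × ℝ => k p.1 p.2) (h : ℝ) :
    Measurable (k h) := hk.comp (measurable_const.prodMk measurable_id)

lemma sqrt_sq_add_sq_mem {s h : ℝ} (hs : 0 ≤ s) (hh : 0 ≤ h) :
    s ≤ √(s ^ 2 + h ^ 2) ∧ √(s ^ 2 + h ^ 2) ≤ s + h := by
  constructor
  · exact Real.le_sqrt_of_sq_le (by nlinarith)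
  · exact (Real.sqrt_le_left (by positivity)).2 (by nlinarith)

/-- The absolute error at `x` of the weighted kernel estimate of `∫ m, k (s i) (x - m) ∂G` from
the noise `ω`. -/
def kernelError {n : ℕ} (G : Measure ℝ) (k : ℝ → ℝ → ℝ) (hx hs : ℝ) (s : Fin n → ℝ) (i : Fin n)
    (x : ℝ) (ω : Fin n → ℝ × ℝ) : ℝ :=
  |∑ j, weight hs s (s i) j * k (hx * s j) (x - (mkTriple (ω j) (s j)).1)
    - ∫ m, k (s i) (x - m) ∂G|

section KernelError

variable {n : ℕ} {G : Measure ℝ} {k : ℝ → ℝ → ℝ}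
  {s : Fin n → ℝ} {σl σu hx hs M v L B lam : ℝ}

/-- Variance plus bias at a fixed point, for `k = phi` and `k = dphi` together. By `hkv` a second
moment is at most `v` times a marginal density, itself at most `1 / σl`; by `hconv` and `hlip` the
bias is a change of standard deviation. -/
lemma integral_kernelError_le [IsProbabilityMeasure G]
    (hk : Measurable fun p : ℝ × ℝ => k p.1 p.2)
    (hσl : 0 < σl) (hsσ : ∀ j, σl ≤ s j ∧ s j ≤ σu) (hx0 : 0 < hx) (hs0 : 0 < hs)
    (hkM : ∀ h z, hx * σl ≤ h → |k h z| ≤ M)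
    (hkv : ∀ h z, hx * σl ≤ h → k h z ^ 2 ≤ v * phi h z) (hv : 0 ≤ v)
    (hconv : ∀ h s u, 0 < h → 0 < s →
      ∫ z, k h (u - s * z) ∂(gaussianReal 0 1) = k (√(s ^ 2 + h ^ 2)) u)
    (hL : 0 ≤ L) (hlip : ∀ s t z, σl ≤ s → σl ≤ t → |k s z - k t z| ≤ L * |s - t|)
    (hB : ∀ σ z, σl ≤ σ → |k σ z| ≤ B) (hlam : 0 < lam) (i : Fin n) (x : ℝ) :
    ∫ ω, kernelError G k hx hs s i x ω ∂(Measure.pi fun _ : Fin n => noiseLaw G)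
      ≤ lam * (v / σl) * weight hs s (s i) i + 1 / lam
        + L * (hx * σu + hs * (Real.log n + 2)) := by
  have hkm := measurable_kernel_left hk
  have hs0' : ∀ j, 0 < s j := fun j => hσl.trans_le (hsσ j).1
  have hh0 : ∀ j, 0 < hx * s j := fun j => mul_pos hx0 (hs0' j)
  have hhl : ∀ j, hx * σl ≤ hx * s j := fun j => mul_le_mul_of_nonneg_left (hsσ j).1 hx0.le
  have hrl : ∀ j, σl ≤ √(s j ^ 2 + (hx * s j) ^ 2) := fun j =>
    (hsσ j).1.trans (sqrt_sq_add_sq_mem (hs0' j).le (hh0 j).le).1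
  set Y : Fin n → ℝ × ℝ → ℝ := fun j ω => k (hx * s j) (x - (mkTriple ω (s j)).1) with hYdef
  have hYm : ∀ j, Measurable (Y j) := fun j =>
    (hkm _).comp (by unfold mkTriple; fun_prop)
  have hYM : ∀ j ω, |Y j ω| ≤ M := fun j ω => hkM _ _ (hhl j)
  have hint : ∀ σ, σl ≤ σ → Integrable (fun m => k σ (x - m)) G := fun σ hσ =>
    integrable_of_measurable_of_abs_le ((hkm σ).comp (by fun_prop)) fun m => hB _ _ hσ
  have hYe : ∀ j, ∫ ω, Y j ω ∂(noiseLaw G) = ∫ m, k (√(s j ^ 2 + (hx * s j) ^ 2)) (x - m) ∂G := by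
    intro j
    rw [integral_noiseLaw (hkm _) (fun z => hkM _ z (hhl j))]
    exact integral_congr_ae (ae_of_all _ fun m => hconv _ _ _ (hh0 j) (hs0' j))
  have hYv : ∀ j, ∫ ω, Y j ω ^ 2 ∂(noiseLaw G) ≤ v / σl := by
    intro j
    have hpb : ∀ z, |phi (hx * s j) z| ≤ 1 / (hx * s j) := fun z => by
      rw [abs_of_pos (phi_pos (hh0 j) z)]; exact phi_le (hh0 j) z
    have hpm := measurable_kernel_left measurable_phi (hx * s j)
    calc _ ≤ ∫ ω, v * phi (hx * s j) (x - (mkTriple ω (s j)).1) ∂(noiseLaw G) := by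
          refine integral_mono (integrable_of_measurable_of_abs_le ((hYm j).pow_const 2)
            (B := M ^ 2) fun ω => ?_)
            ((integrable_noiseLaw_of_abs_le hpm hpb _ _).const_mul v) fun ω => hkv _ _ (hhl j)
          rw [abs_pow]; exact pow_le_pow_left₀ (abs_nonneg _) (hYM j ω) 2
      _ = v * marginal G (√(s j ^ 2 + (hx * s j) ^ 2)) x := by
          rw [integral_const_mul, integral_noiseLaw hpm hpb]
          simp_rw [integral_phi_gaussianReal (hh0 j) (hs0' j)]
          rfl
      _ ≤ v * (1 / σl) := by
          gcongr
          exact (marginal_le (hσl.trans_le (hrl j)) x).trans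
            (one_div_le_one_div_of_le hσl (hrl j))
      _ = _ := by ring
  have h1 := integral_abs_weighted_sum_sub_le (noiseLaw G) hYm hYM (weight hs s (s i)) hYv hlam
  -- The bias: since the weights sum to one, it is a weighted mean of differences of `k` at two
  -- standard deviations.
  have h2 : |∑ j, weight hs s (s i) j * ∫ ω, Y j ω ∂(noiseLaw G) - ∫ m, k (s i) (x - m) ∂G|
      ≤ L * (hx * σu + hs * (Real.log n + 2)) := by
    have e : ∑ j, weight hs s (s i) j * ∫ ω, Y j ω ∂(noiseLaw G) - ∫ m, k (s i) (x - m) ∂G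
        = ∑ j, weight hs s (s i) j *
          ∫ m, (k (√(s j ^ 2 + (hx * s j) ^ 2)) (x - m) - k (s i) (x - m)) ∂G := by
      rw [← one_mul (∫ m, k (s i) (x - m) ∂G), ← sum_weight (s := s) hs0 i, Finset.sum_mul,
        ← Finset.sum_sub_distrib]
      refine Finset.sum_congr rfl fun j _ => ?_
      rw [hYe, integral_sub (hint _ (hrl j)) (hint _ (hsσ i).1)]; ring
    rw [e]
    calc _ ≤ ∑ j, weight hs s (s i) j * (L * (hx * σu + |s i - s j|)) := by
          refine (Finset.abs_sum_le_sum_abs _ _).trans (Finset.sum_le_sum fun j _ => ?_)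
          rw [abs_mul, abs_of_nonneg (weight_nonneg hs0 _ _)]
          refine mul_le_mul_of_nonneg_left ?_ (weight_nonneg hs0 _ _)
          have hj := sqrt_sq_add_sq_mem (hs0' j).le (hh0 j).le
          have hd : |√(s j ^ 2 + (hx * s j) ^ 2) - s i| ≤ hx * σu + |s i - s j| := by
            have h3 : hx * s j ≤ hx * σu := mul_le_mul_of_nonneg_left (hsσ j).2 hx0.le
            have h4 := le_abs_self (s i - s j)
            have h5 := neg_abs_le (s i - s j)
            have := hh0 j
            rw [abs_le]; constructor <;> linarith [hj.1, hj.2]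
          have := norm_integral_le_of_norm_le_const (μ := G)
            (f := fun m => k (√(s j ^ 2 + (hx * s j) ^ 2)) (x - m) - k (s i) (x - m))
            (C := L * |√(s j ^ 2 + (hx * s j) ^ 2) - s i|)
            (ae_of_all _ fun m => hlip _ _ _ (hrl j) (hsσ i).1)
          rw [probReal_univ, mul_one, Real.norm_eq_abs] at this
          exact this.trans (mul_le_mul_of_nonneg_left hd hL)
      _ = L * (hx * σu * ∑ j, weight hs s (s i) j
          + ∑ j, weight hs s (s i) j * |s i - s j|) := by
          rw [Finset.mul_sum, ← Finset.sum_add_distrib, Finset.mul_sum]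
          exact Finset.sum_congr rfl fun j _ => by ring
      _ ≤ _ := by
          rw [sum_weight hs0, mul_one]
          gcongr; exact sum_weight_mul_abs_le hs0 i
  have hSm : Measurable fun ω : Fin n → ℝ × ℝ => ∑ j, weight hs s (s i) j * Y j (ω j) :=
    Finset.measurable_sum _ fun j _ => ((hYm j).comp (measurable_pi_apply j)).const_mul _
  have hSb : ∀ ω : Fin n → ℝ × ℝ, |∑ j, weight hs s (s i) j * Y j (ω j)| ≤ M := fun ω => by
    calc _ ≤ ∑ j, weight hs s (s i) j * M := by
          refine (Finset.abs_sum_le_sum_abs _ _).trans (Finset.sum_le_sum fun j _ => ?_)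
          rw [abs_mul, abs_of_nonneg (weight_nonneg hs0 _ _)]
          exact mul_le_mul_of_nonneg_left (hYM j _) (weight_nonneg hs0 _ _)
      _ = M := by rw [← Finset.sum_mul, sum_weight hs0, one_mul]
  have hSi : ∀ c : ℝ, Integrable (fun ω : Fin n → ℝ × ℝ =>
      |∑ j, weight hs s (s i) j * Y j (ω j) - c|) (Measure.pi fun _ : Fin n => noiseLaw G) :=
    fun c => integrable_of_measurable_of_abs_le (hSm.sub_const c).norm (B := M + |c|) fun ω => by
      rw [abs_abs]
      exact (abs_sub _ _).trans (add_le_add_left (hSb ω) _)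
  set e := ∑ j, weight hs s (s i) j * ∫ ω, Y j ω ∂(noiseLaw G)
  calc _ ≤ ∫ ω, (|∑ j, weight hs s (s i) j * Y j (ω j) - e| + |e - ∫ m, k (s i) (x - m) ∂G|)
        ∂(Measure.pi fun _ : Fin n => noiseLaw G) :=
        integral_mono (hSi _) ((hSi _).add (integrable_const _)) fun ω => abs_sub_le _ _ _
    _ = ∫ ω, |∑ j, weight hs s (s i) j * Y j (ω j) - e| ∂(Measure.pi fun _ : Fin n => noiseLaw G)
        + |e - ∫ m, k (s i) (x - m) ∂G| := by
        rw [integral_add (hSi _) (integrable_const _)]; simp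
    _ ≤ (lam * (v / σl) * ∑ j, weight hs s (s i) j ^ 2 + 1 / lam)
        + L * (hx * σu + hs * (Real.log n + 2)) := add_le_add h1 h2
    _ ≤ _ := by
        gcongr; exact sum_weight_sq_le hs0 i

lemma measurable_kernelError [IsProbabilityMeasure G]
    (hk : Measurable fun p : ℝ × ℝ => k p.1 p.2) (i : Fin n) :
    Measurable fun q : ℝ × (Fin n → ℝ × ℝ) => kernelError G k hx hs s i q.1 q.2 := by
  have hkm := measurable_kernel_left hk
  have hAm : Measurable fun x => ∫ m, k (s i) (x - m) ∂G := by
    have : StronglyMeasurable fun q : ℝ × ℝ => k (s i) (q.1 - q.2) :=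
      ((hkm (s i)).comp (by fun_prop : Measurable fun q : ℝ × ℝ => q.1 - q.2)).stronglyMeasurable
    exact (this.integral_prod_right (ν := G)).measurable
  have hXm : ∀ σ, Measurable fun ω => (mkTriple ω σ).1 := fun σ => by unfold mkTriple; fun_prop
  refine Measurable.norm (Measurable.sub (Finset.measurable_sum _ fun j _ =>
    Measurable.const_mul ((hkm _).comp ?_) _) (hAm.comp measurable_fst))
  exact measurable_fst.sub ((hXm _).comp (by fun_prop))

lemma abs_kernelError_le [IsProbabilityMeasure G]
    (hsσ : ∀ j, σl ≤ s j ∧ s j ≤ σu) (hx0 : 0 < hx) (hs0 : 0 < hs)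
    (hkM : ∀ h z, hx * σl ≤ h → |k h z| ≤ M) (hB : ∀ σ z, σl ≤ σ → |k σ z| ≤ B) (i : Fin n)
    (x : ℝ) (ω : Fin n → ℝ × ℝ) : |kernelError G k hx hs s i x ω| ≤ M + B := by
  have hhl : ∀ j, hx * σl ≤ hx * s j := fun j => mul_le_mul_of_nonneg_left (hsσ j).1 hx0.le
  have hAb : |∫ m, k (s i) (x - m) ∂G| ≤ B := by
    have := norm_integral_le_of_norm_le_const (μ := G) (f := fun m => k (s i) (x - m))
      (C := B) (ae_of_all _ fun m => hB _ _ (hsσ i).1)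
    simpa using this
  rw [kernelError, abs_abs]
  refine (abs_sub _ _).trans (add_le_add ?_ hAb)
  calc _ ≤ ∑ j, weight hs s (s i) j * M := by
        refine (Finset.abs_sum_le_sum_abs _ _).trans (Finset.sum_le_sum fun j _ => ?_)
        rw [abs_mul, abs_of_nonneg (weight_nonneg hs0 _ _)]
        exact mul_le_mul_of_nonneg_left (hkM _ _ (hhl j)) (weight_nonneg hs0 _ _)
    _ = M := by rw [← Finset.sum_mul, sum_weight hs0, one_mul]

/-- Only the `i`-th summand sees the change, and it moves by at most `2 * M` times its weight. -/
lemma kernelError_update_le (hsσ : ∀ j, σl ≤ s j ∧ s j ≤ σu) (hx0 : 0 < hx) (hs0 : 0 < hs)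
    (hkM : ∀ h z, hx * σl ≤ h → |k h z| ≤ M) (i : Fin n) (x : ℝ) (ω : Fin n → ℝ × ℝ)
    (ω₀ : ℝ × ℝ) :
    kernelError G k hx hs s i x (Function.update ω i ω₀)
      ≤ kernelError G k hx hs s i x ω + weight hs s (s i) i * (2 * M) := by
  have hhl : ∀ j, hx * σl ≤ hx * s j := fun j => mul_le_mul_of_nonneg_left (hsσ j).1 hx0.le
  have hd : ∑ j, weight hs s (s i) j *
        k (hx * s j) (x - (mkTriple (Function.update ω i ω₀ j) (s j)).1)
      - ∑ j, weight hs s (s i) j * k (hx * s j) (x - (mkTriple (ω j) (s j)).1)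
      = weight hs s (s i) i * (k (hx * s i) (x - (mkTriple ω₀ (s i)).1)
        - k (hx * s i) (x - (mkTriple (ω i) (s i)).1)) := by
    rw [← Finset.sum_sub_distrib, Finset.sum_eq_single i]
    · simp only [Function.update_self]; ring
    · intro j _ hj; rw [Function.update_of_ne hj]; ring
    · simp
  have hd' : |∑ j, weight hs s (s i) j *
        k (hx * s j) (x - (mkTriple (Function.update ω i ω₀ j) (s j)).1)
      - ∑ j, weight hs s (s i) j * k (hx * s j) (x - (mkTriple (ω j) (s j)).1)|
      ≤ weight hs s (s i) i * (2 * M) := by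
    rw [hd, abs_mul, abs_of_nonneg (weight_nonneg hs0 _ _)]
    refine mul_le_mul_of_nonneg_left ((abs_sub _ _).trans ?_) (weight_nonneg hs0 _ _)
    linarith [hkM (hx * s i) (x - (mkTriple ω₀ (s i)).1) (hhl i),
      hkM (hx * s i) (x - (mkTriple (ω i) (s i)).1) (hhl i)]
  rw [kernelError, kernelError]
  refine (abs_sub_le _ (∑ j, weight hs s (s i) j *
    k (hx * s j) (x - (mkTriple (ω j) (s j)).1)) _).trans ?_
  rw [add_comm]
  exact add_le_add_right hd' _

attribute [irreducible] kernelError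

lemma measurable_kernelError_self [IsProbabilityMeasure G]
    (hk : Measurable fun p : ℝ × ℝ => k p.1 p.2) (i : Fin n) :
    Measurable fun ω : Fin n → ℝ × ℝ => kernelError G k hx hs s i (mkTriple (ω i) (s i)).1 ω := by
  have hX : Measurable fun ω : Fin n → ℝ × ℝ => ((mkTriple (ω i) (s i)).1, ω) := by
    unfold mkTriple; fun_prop
  have h := measurable_kernelError (G := G) (hx := hx) (hs := hs) (s := s) hk i
  exact h.comp hX

/-- The mean absolute error of the kernel estimate at the `i`-th observation, which itself enters
the estimate. -/
lemma integral_kernelError_self_le [IsProbabilityMeasure G]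
    (hk : Measurable fun p : ℝ × ℝ => k p.1 p.2)
    (hσl : 0 < σl) (hsσ : ∀ j, σl ≤ s j ∧ s j ≤ σu) (hx0 : 0 < hx) (hs0 : 0 < hs)
    (hkM : ∀ h z, hx * σl ≤ h → |k h z| ≤ M)
    (hkv : ∀ h z, hx * σl ≤ h → k h z ^ 2 ≤ v * phi h z) (hv : 0 ≤ v)
    (hconv : ∀ h s u, 0 < h → 0 < s →
      ∫ z, k h (u - s * z) ∂(gaussianReal 0 1) = k (√(s ^ 2 + h ^ 2)) u)
    (hL : 0 ≤ L) (hlip : ∀ s t z, σl ≤ s → σl ≤ t → |k s z - k t z| ≤ L * |s - t|)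
    (hB : ∀ σ z, σl ≤ σ → |k σ z| ≤ B) (hlam : 0 < lam) (i : Fin n) :
    ∫ ω, kernelError G k hx hs s i (mkTriple (ω i) (s i)).1 ω
        ∂(Measure.pi fun _ : Fin n => noiseLaw G)
      ≤ (lam * (v / σl) + 2 * M) * weight hs s (s i) i + 1 / lam
        + L * (hx * σu + hs * (Real.log n + 2)) := by
  have hFm := measurable_kernelError_self (G := G) (hx := hx) (hs := hs) (s := s) hk i
  have hb := abs_kernelError_le (G := G) hsσ hx0 hs0 hkM hB i
  have hmp := measurePreserving_update (noiseLaw G) i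
  have hE := measurable_kernelError (G := G) (hx := hx) (hs := hs) (s := s) hk i
  have hEx : ∀ x, Measurable (kernelError G k hx hs s i x) := fun x =>
    hE.comp measurable_prodMk_left
  have hFint : Integrable (fun p : (ℝ × ℝ) × (Fin n → ℝ × ℝ) =>
      kernelError G k hx hs s i (mkTriple (Function.update p.2 i p.1 i) (s i)).1
        (Function.update p.2 i p.1))
      ((noiseLaw G).prod (Measure.pi fun _ : Fin n => noiseLaw G)) :=
    integrable_of_measurable_of_abs_le (hFm.comp hmp.measurable) fun ω => hb _ _
  have hxi : ∀ x, Integrable (kernelError G k hx hs s i x)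
      (Measure.pi fun _ : Fin n => noiseLaw G) := fun x =>
    integrable_of_measurable_of_abs_le (hEx x) (hb x)
  -- Resample the `i`-th noise as `ω₀`: the evaluation point then depends on `ω₀` alone and is fixed
  -- while integrating over `ω`.
  rw [← hmp.map_eq, integral_map hmp.measurable.aemeasurable hFm.aestronglyMeasurable,
    integral_prod _ hFint]
  refine integral_le_of_le hFint.integral_prod_left (ae_of_all _ fun ω₀ => ?_)
  simp only [Function.update_self]
  generalize (mkTriple ω₀ (s i)).1 = x
  calc _ ≤ ∫ ω, (kernelError G k hx hs s i x ω + weight hs s (s i) i * (2 * M))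
        ∂(Measure.pi fun _ : Fin n => noiseLaw G) := by
        refine integral_mono (integrable_of_measurable_of_abs_le ?_ fun ω => hb x _)
          ((hxi x).add (integrable_const _)) fun ω => kernelError_update_le hsσ hx0 hs0 hkM i x ω ω₀
        exact (hEx x).comp (hmp.measurable.comp measurable_prodMk_left)
    _ = ∫ ω, kernelError G k hx hs s i x ω ∂(Measure.pi fun _ : Fin n => noiseLaw G)
        + weight hs s (s i) i * (2 * M) := by
        rw [integral_add (hxi x) (integrable_const _)]; simp
    _ ≤ _ := by
        have := integral_kernelError_le (G := G) hk hσl hsσ hx0 hs0 hkM hkv hv hconv hL hlip hB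
          hlam i x
        linarith

end KernelError

/-! ### The NEST rule -/

/-- The derivative in `t` of the density estimate `kde hx hs x s σ t`. -/
def dkde {n : ℕ} (hx hs : ℝ) (x s : Fin n → ℝ) (σ t : ℝ) : ℝ :=
  ∑ j, weight hs s σ j * dphi (hx * s j) (t - x j)

lemma deriv_kde {n : ℕ} (hx hs : ℝ) (x s : Fin n → ℝ) (σ t : ℝ) :
    deriv (kde hx hs x s σ) t = dkde hx hs x s σ t := by
  refine HasDerivAt.deriv ?_
  unfold kde dkde
  exact HasDerivAt.fun_sum fun j _ => ((hasDerivAt_phi _ _).comp_sub_const t _).const_mul _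

/-- For `T ≤ 0` the clipped value is the constant `-T`; the bound by `|T|` thus gives finite risk
for every `n`, also where the truncation level is negative. -/
lemma abs_clip_le (T r : ℝ) : |max (-T) (min T r)| ≤ |T| := by
  rcases le_total 0 T with h | h
  · rw [abs_of_nonneg h, abs_le]
    exact ⟨le_max_left _ _, max_le (by linarith) (min_le_left _ _)⟩
  · rw [max_eq_left ((min_le_left _ _).trans (by linarith)), abs_neg]

/-- Clipping is 1-Lipschitz and fixes `o`. -/
lemma abs_clip_sub_le {T r o : ℝ} (ho : |o| ≤ T) : |max (-T) (min T r) - o| ≤ |r - o| := by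
  have e : max (-T) (min T o) = o := by
    rw [min_eq_right (abs_le.1 ho).2, max_eq_right (abs_le.1 ho).1]
  calc |max (-T) (min T r) - o| = |max (-T) (min T r) - max (-T) (min T o)| := by rw [e]
    _ ≤ |min T r - min T o| := by
      simpa using abs_max_sub_max_le_max (-T) (min T r) (-T) (min T o)
    _ ≤ |r - o| := by simpa using abs_min_sub_min_le_max T r T o

section Measurability

variable {n : ℕ}

lemma measurable_weight (hs : ℝ) (i j : Fin n) :
    Measurable fun D : Fin n → ℝ × ℝ × ℝ => weight hs (fun j => (D j).2.2) (D i).2.2 j := by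
  unfold weight phi; fun_prop

lemma measurable_kernel_sum {k : ℝ → ℝ → ℝ} (hk : Measurable fun p : ℝ × ℝ => k p.1 p.2)
    (hx hs : ℝ) (i : Fin n) :
    Measurable fun D : Fin n → ℝ × ℝ × ℝ => ∑ j, weight hs (fun j => (D j).2.2) (D i).2.2 j
      * k (hx * (D j).2.2) ((D i).1 - (D j).1) := by
  refine Finset.measurable_sum _ fun j _ => (measurable_weight hs i j).mul ?_
  exact hk.comp (by fun_prop : Measurable fun D : Fin n → ℝ × ℝ × ℝ =>
    (hx * (D j).2.2, (D i).1 - (D j).1))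

lemma measurable_nest (T hx hs : ℝ) (i : Fin n) :
    Measurable fun D : Fin n → ℝ × ℝ × ℝ =>
      nest T hx hs (fun j => (D j).1) (fun j => (D j).2.2) i := by
  have h1 := measurable_kernel_sum measurable_phi hx hs i
  have h2 := measurable_kernel_sum measurable_dphi hx hs i
  unfold nest nestRaw
  simp_rw [deriv_kde]
  refine measurable_const.max (measurable_const.min (Measurable.add (by fun_prop) ?_))
  exact Measurable.mul (by fun_prop) (h2.div h1)

end Measurability

/-- The error at the `i`-th observation of the estimates of the marginal density and of its
derivative. -/
def estError {n : ℕ} (G : Measure ℝ) (hx hs : ℝ) (i : Fin n) (D : Fin n → ℝ × ℝ × ℝ) : ℝ :=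
  |kde hx hs (fun j => (D j).1) (fun j => (D j).2.2) (D i).2.2 (D i).1
      - marginal G (D i).2.2 (D i).1|
    + |dkde hx hs (fun j => (D j).1) (fun j => (D j).2.2) (D i).2.2 (D i).1
      - dmarginal G (D i).2.2 (D i).1|

lemma measurable_estError {n : ℕ} (G : Measure ℝ) [IsProbabilityMeasure G] (hx hs : ℝ)
    (i : Fin n) : Measurable (estError G hx hs i) := by
  have h1 := measurable_kernel_sum measurable_phi hx hs i
  have h2 := measurable_kernel_sum measurable_dphi hx hs i
  have hp : Measurable fun D : Fin n → ℝ × ℝ × ℝ => ((D i).2.2, (D i).1) := by fun_prop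
  have h3 := (measurable_marginal (G := G)).comp hp
  have h4 := (measurable_dmarginal (G := G)).comp hp
  exact (h1.sub h3).norm.add (h2.sub h4).norm

lemma estError_mkTriple {n : ℕ} (G : Measure ℝ) (hx hs : ℝ) (i : Fin n) (ω : Fin n → ℝ × ℝ)
    (s : Fin n → ℝ) :
    estError G hx hs i (fun j => mkTriple (ω j) (s j))
      = kernelError G phi hx hs s i (mkTriple (ω i) (s i)).1 ω
        + kernelError G dphi hx hs s i (mkTriple (ω i) (s i)).1 ω := by
  rw [kernelError, kernelError]
  rfl

/-- Here `a, a'` are the true density and derivative and `b, b'` arbitrary estimates. If `|b - a| ≤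
a / 2`, then `b ≥ a / 2` and the quotient is stable. Otherwise `1 < 2 |b - a| / a`, and the trivial
bound `2 * T` suffices; `τ ≤ 1` brings `1 / a` below `1 / τ ^ 2`. -/
lemma abs_nest_sub_le {T x σ a a' b b' V c τ : ℝ} (hτ : 0 < τ) (hτ1 : τ ≤ 1) (ha : τ ≤ a)
    (ho : |x + σ ^ 2 * (a' / a)| ≤ T) (hσ : σ ^ 2 ≤ V) (hc : |a'| ≤ c) :
    |max (-T) (min T (x + σ ^ 2 * (b' / b))) - (x + σ ^ 2 * (a' / a))|
      ≤ (4 * T + 2 * V * (1 + c)) / τ ^ 2 * (|b - a| + |b' - a'|) := by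
  have ha0 : 0 < a := hτ.trans_le ha
  have hT : 0 ≤ T := (abs_nonneg _).trans ho
  have hV : 0 ≤ V := (sq_nonneg _).trans hσ
  have hc0 : 0 ≤ c := (abs_nonneg _).trans hc
  have hd := abs_nonneg (b - a)
  have hd' := abs_nonneg (b' - a')
  have hτ2 : τ ^ 2 ≤ a := by nlinarith
  have hτ3 : τ ^ 2 ≤ a ^ 2 := by gcongr
  rcases le_or_gt |b - a| (a / 2) with h | h
  · have hb : a / 2 ≤ b := by linarith [(abs_le.1 h).1]
    have hb0 : 0 < b := by linarith
    refine (abs_clip_sub_le ho).trans ?_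
    have e : x + σ ^ 2 * (b' / b) - (x + σ ^ 2 * (a' / a))
        = σ ^ 2 * ((b' - a') / b - a' * (b - a) / (b * a)) := by field_simp; ring
    rw [e, abs_mul, abs_of_nonneg (sq_nonneg σ)]
    have h1 : |(b' - a') / b| ≤ 2 * |b' - a'| / τ ^ 2 := by
      rw [abs_div, abs_of_pos hb0]
      calc _ ≤ |b' - a'| / (a / 2) := by gcongr
        _ = 2 * |b' - a'| / a := by field_simp
        _ ≤ _ := by gcongr
    have h2 : |a' * (b - a) / (b * a)| ≤ 2 * (c * |b - a|) / τ ^ 2 := by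
      rw [abs_div, abs_mul, abs_of_pos (mul_pos hb0 ha0)]
      calc _ ≤ c * |b - a| / (a / 2 * a) := by gcongr
        _ = 2 * (c * |b - a|) / a ^ 2 := by field_simp
        _ ≤ _ := by gcongr
    calc _ ≤ V * (2 * |b' - a'| / τ ^ 2 + 2 * (c * |b - a|) / τ ^ 2) := by
          gcongr
          exact (abs_sub _ _).trans (add_le_add h1 h2)
      _ = (2 * V * |b' - a'| + 2 * V * c * |b - a|) / τ ^ 2 := by ring
      _ ≤ ((4 * T + 2 * V * (1 + c)) * (|b - a| + |b' - a'|)) / τ ^ 2 := by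
          gcongr
          have := mul_nonneg hT (add_nonneg hd hd')
          have := mul_nonneg hV hd
          have := mul_nonneg (mul_nonneg hV hc0) hd'
          linarith
      _ = _ := by ring
  · have h1 : |max (-T) (min T (x + σ ^ 2 * (b' / b))) - (x + σ ^ 2 * (a' / a))| ≤ 2 * T := by
      refine (abs_sub _ _).trans ?_
      have := abs_clip_le T (x + σ ^ 2 * (b' / b))
      rw [abs_of_nonneg hT] at this
      linarith
    have h2 : 1 ≤ 2 * |b - a| / τ ^ 2 := by
      rw [le_div_iff₀ (by positivity)]; linarith
    calc _ ≤ 2 * T * 1 := by linarith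
      _ ≤ 2 * T * (2 * |b - a| / τ ^ 2) := by gcongr
      _ = (4 * T * |b - a|) / τ ^ 2 := by ring
      _ ≤ ((4 * T + 2 * V * (1 + c)) * (|b - a| + |b' - a'|)) / τ ^ 2 := by
          gcongr
          · nlinarith [mul_nonneg hV hc0]
          · linarith
      _ = _ := by ring

/-! ### Almost sure bounds and small densities -/

section Law

variable {Gμ Gσ : Measure ℝ} [IsProbabilityMeasure Gμ] [IsProbabilityMeasure Gσ]
  {C σl σu : ℝ}

lemma ae_pos_of_ae_mem {Gσ : Measure ℝ} (hσl : 0 < σl) (hσ : ∀ᵐ s ∂Gσ, σl ≤ s ∧ s ≤ σu) :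
    ∀ᵐ s ∂Gσ, 0 < s := by
  filter_upwards [hσ] with s hs using hσl.trans_le hs.1

lemma ae_tripleLaw {Gμ Gσ : Measure ℝ} [SFinite Gσ] (hC : ∀ᵐ m ∂Gμ, |m| ≤ C)
    (hσ : ∀ᵐ s ∂Gσ, σl ≤ s ∧ s ≤ σu) :
    ∀ᵐ p ∂(tripleLaw Gμ Gσ), |p.2.1| ≤ C ∧ σl ≤ p.2.2 ∧ p.2.2 ≤ σu := by
  refine (withDensity_absolutelyContinuous _ _).ae_le ?_
  have h1 : ∀ᵐ q ∂(Gμ.prod Gσ), |q.1| ≤ C ∧ σl ≤ q.2 ∧ q.2 ≤ σu :=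
    (Measure.quasiMeasurePreserving_fst.ae hC).and (Measure.quasiMeasurePreserving_snd.ae hσ)
  exact (Measure.quasiMeasurePreserving_snd (μ := (volume : Measure ℝ))).ae h1

lemma ae_pi_forall {ι α : Type*} [Fintype ι] [MeasurableSpace α] {P : Measure α}
    [IsProbabilityMeasure P] {p : α → Prop} (h : ∀ᵐ x ∂P, p x) :
    ∀ᵐ x ∂(Measure.pi fun _ : ι => P), ∀ i, p (x i) :=
  ae_all_iff.2 fun i =>
    (measurePreserving_eval (fun _ : ι => P) i).quasiMeasurePreserving.ae h

lemma lintegral_phi_eq {σ : ℝ} (hσ : 0 < σ) (x : ℝ) :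
    ∫⁻ m, ENNReal.ofReal (phi σ (x - m)) ∂Gμ = ENNReal.ofReal (marginal Gμ σ x) := by
  rw [marginal, ofReal_integral_eq_lintegral_ofReal (integrable_phi_sub hσ x)
    (ae_of_all _ fun m => (phi_pos hσ _).le)]

/-- For given `s`, integrating the mean out of the joint density leaves the marginal density, less
than `τ` on the event, and `x` ranges over length `2 * R`. -/
lemma tripleLaw_marginal_lt_inter_le (hσ : ∀ᵐ s ∂Gσ, 0 < s) {τ R : ℝ} :
    tripleLaw Gμ Gσ {p | marginal Gμ p.2.2 p.1 < τ ∧ p.1 ∈ Set.Icc (-R) R}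
      ≤ ENNReal.ofReal τ * ENNReal.ofReal (2 * R) := by
  have hm : Measurable fun p : ℝ × ℝ × ℝ => ENNReal.ofReal (phi p.2.2 (p.1 - p.2.1)) :=
    (measurable_phi.comp (by fun_prop : Measurable fun p : ℝ × ℝ × ℝ =>
      (p.2.2, p.1 - p.2.1))).ennreal_ofReal
  have hM : Measurable fun p : ℝ × ℝ × ℝ => marginal Gμ p.2.2 p.1 :=
    measurable_marginal.comp (by fun_prop : Measurable fun p : ℝ × ℝ × ℝ => (p.2.2, p.1))
  have hS : MeasurableSet {p : ℝ × ℝ × ℝ | marginal Gμ p.2.2 p.1 < τ ∧ p.1 ∈ Set.Icc (-R) R} :=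
    (measurableSet_lt hM measurable_const).inter (measurable_fst measurableSet_Icc)
  set S := {p : ℝ × ℝ × ℝ | marginal Gμ p.2.2 p.1 < τ ∧ p.1 ∈ Set.Icc (-R) R}
  rw [tripleLaw, withDensity_apply _ hS, ← lintegral_indicator hS,
    lintegral_prod _ (hm.indicator hS).aemeasurable]
  have key : ∀ x, ∫⁻ q, S.indicator (fun p => ENNReal.ofReal (phi p.2.2 (p.1 - p.2.1))) (x, q)
      ∂(Gμ.prod Gσ) ≤ (Set.Icc (-R) R).indicator (fun _ => ENNReal.ofReal τ) x := by
    intro x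
    by_cases hx : x ∈ Set.Icc (-R) R
    · rw [Set.indicator_of_mem hx, lintegral_prod_symm']
      swap
      · exact (hm.indicator hS).comp measurable_prodMk_left
      calc _ ≤ ∫⁻ _s, ENNReal.ofReal τ ∂Gσ := by
            refine lintegral_mono_ae ?_
            filter_upwards [hσ] with s hs
            by_cases ht : marginal Gμ s x < τ
            · calc _ ≤ ∫⁻ m, ENNReal.ofReal (phi s (x - m)) ∂Gμ :=
                    lintegral_mono fun m => Set.indicator_le_self S
                      (fun p => ENNReal.ofReal (phi p.2.2 (p.1 - p.2.1))) (x, m, s)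
                _ = ENNReal.ofReal (marginal Gμ s x) := lintegral_phi_eq hs x
                _ ≤ _ := ENNReal.ofReal_le_ofReal ht.le
            · have : ∀ m, S.indicator (fun p => ENNReal.ofReal (phi p.2.2 (p.1 - p.2.1)))
                  (x, m, s) = 0 := fun m => Set.indicator_of_notMem (fun h => ht h.1) _
              simp [this]
        _ = _ := by simp
    · have : ∀ q, S.indicator (fun p => ENNReal.ofReal (phi p.2.2 (p.1 - p.2.1)))
          (x, q) = 0 := fun m => Set.indicator_of_notMem (fun h => hx h.2) _
      simp [this]
  calc _ ≤ ∫⁻ x, (Set.Icc (-R) R).indicator (fun _ => ENNReal.ofReal τ) x := lintegral_mono key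
    _ = _ := by
      rw [lintegral_indicator_const measurableSet_Icc, Real.volume_Icc]; congr 2; ring

lemma integrable_sq_gaussianReal : Integrable (fun z : ℝ => z ^ 2) (gaussianReal 0 1) :=
  (memLp_id_gaussianReal (μ := 0) (v := 1) 2).integrable_sq

lemma integral_sq_gaussianReal : ∫ z : ℝ, z ^ 2 ∂(gaussianReal 0 1) = 1 := by
  have h := variance_id_gaussianReal (μ := 0) (v := 1)
  rw [variance_eq_integral measurable_id.aemeasurable] at h
  simpa [integral_id_gaussianReal] using h

/-- Markov's inequality for `2 C² + 2 σu² z²`, which dominates `X² = (μ + σ z)²`. -/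
lemma tripleLaw_abs_gt_le (hC : ∀ᵐ m ∂Gμ, |m| ≤ C) (hσl : 0 < σl)
    (hσ : ∀ᵐ s ∂Gσ, σl ≤ s ∧ s ≤ σu) {R : ℝ} (hR : 0 < R) :
    (tripleLaw Gμ Gσ).real {p | p.1 ∉ Set.Icc (-R) R} ≤ (2 * C ^ 2 + 2 * σu ^ 2) / R ^ 2 := by
  have hpos := ae_pos_of_ae_mem hσl hσ
  set Q := (noiseLaw Gμ).prod Gσ
  have hmp1 : MeasurePreserving (fun q : (ℝ × ℝ) × ℝ => q.1.1) Q (gaussianReal 0 1) :=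
    (measurePreserving_fst (μ := gaussianReal 0 1) (ν := Gμ)).comp
      (measurePreserving_fst (μ := noiseLaw Gμ) (ν := Gσ))
  have hi : Integrable (fun q : (ℝ × ℝ) × ℝ => q.1.1 ^ 2) Q :=
    hmp1.integrable_comp_of_integrable integrable_sq_gaussianReal
  have hint : ∫ q, q.1.1 ^ 2 ∂Q = 1 := by
    rw [← integral_sq_gaussianReal, ← hmp1.map_eq,
      integral_map hmp1.measurable.aemeasurable (by fun_prop)]
  have hmar := mul_meas_ge_le_integral_of_nonneg (μ := Q)
    (f := fun q => 2 * C ^ 2 + 2 * σu ^ 2 * q.1.1 ^ 2) (ae_of_all _ fun q => by positivity)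
    ((integrable_const _).add (hi.const_mul _)) (R ^ 2)
  rw [integral_add (integrable_const _) (hi.const_mul _), integral_const_mul (2 * σu ^ 2),
    hint, integral_const, probReal_univ, one_smul, mul_one] at hmar
  rw [le_div_iff₀ (by positivity), mul_comm]
  refine le_trans ?_ hmar
  gcongr
  have hSm : MeasurableSet {p : ℝ × ℝ × ℝ | p.1 ∉ Set.Icc (-R) R} :=
    measurable_fst measurableSet_Icc.compl
  rw [tripleLaw_eq_map Gμ Gσ hpos, map_measureReal_apply measurable_mkTriple hSm]
  refine ENNReal.toReal_mono (measure_ne_top _ _) (measure_mono_ae ?_)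
  have hCq : ∀ᵐ q ∂Q, |q.1.2| ≤ C := Measure.quasiMeasurePreserving_fst.ae
    (Measure.quasiMeasurePreserving_snd.ae hC)
  have hσq : ∀ᵐ q ∂Q, σl ≤ q.2 ∧ q.2 ≤ σu := Measure.quasiMeasurePreserving_snd.ae hσ
  filter_upwards [hCq, hσq] with q h1 h2 h3
  change R ^ 2 ≤ 2 * C ^ 2 + 2 * σu ^ 2 * q.1.1 ^ 2
  change ¬ (_ ∈ Set.Icc (-R) R) at h3
  rw [Set.mem_Icc, ← abs_le, not_le] at h3
  change R < |q.1.2 + q.2 * q.1.1| at h3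
  have h4 : R ^ 2 ≤ (q.1.2 + q.2 * q.1.1) ^ 2 := by
    rw [← sq_abs (q.1.2 + _)]; gcongr
  have h5 : q.1.2 ^ 2 ≤ C ^ 2 := by rw [← sq_abs]; gcongr
  have h6 : q.2 ^ 2 * q.1.1 ^ 2 ≤ σu ^ 2 * q.1.1 ^ 2 := by
    have : 0 ≤ q.2 := hσl.le.trans h2.1
    gcongr; exact h2.2
  nlinarith [sq_nonneg (q.1.2 - q.2 * q.1.1)]

/-- The marginal density is unlikely to be small at the observation. -/
lemma tripleLaw_marginal_lt_le (hC : ∀ᵐ m ∂Gμ, |m| ≤ C) (hσl : 0 < σl)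
    (hσ : ∀ᵐ s ∂Gσ, σl ≤ s ∧ s ≤ σu) {R τ : ℝ} (hR : 0 < R) (hτ : 0 < τ) :
    (tripleLaw Gμ Gσ).real {p | marginal Gμ p.2.2 p.1 < τ}
      ≤ 2 * R * τ + (2 * C ^ 2 + 2 * σu ^ 2) / R ^ 2 := by
  have hpos := ae_pos_of_ae_mem hσl hσ
  have := isProbabilityMeasure_tripleLaw Gμ Gσ hpos
  have h1 : (tripleLaw Gμ Gσ).real {p | marginal Gμ p.2.2 p.1 < τ ∧ p.1 ∈ Set.Icc (-R) R}
      ≤ 2 * R * τ := by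
    refine ENNReal.toReal_le_of_le_ofReal (by positivity)
      ((tripleLaw_marginal_lt_inter_le hpos).trans_eq ?_)
    rw [← ENNReal.ofReal_mul hτ.le, mul_comm]
  refine le_trans ?_ (add_le_add h1 (tripleLaw_abs_gt_le hC hσl hσ hR))
  refine le_trans (measureReal_mono ?_) (measureReal_union_le _ _)
  intro p hp
  by_cases hx : p.1 ∈ Set.Icc (-R) R
  · exact Or.inl ⟨hp, hx⟩
  · exact Or.inr hx

end Law

/-! ### Comparison of the risks for a fixed sample size -/

/-- A bound for the mean estimation error, averaged over the observations; `lam` is a free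
positive parameter. -/
def errorBound (σl σu hx hs lam : ℝ) (n : ℕ) : ℝ :=
  (lam * (1 / (hx * σl) / σl) + 2 * (1 / (hx * σl))
      + (lam * (2 / (hx * σl) ^ 3 / σl) + 2 * (2 / (hx * σl) ^ 2)))
      * (2 * ((σu - σl) / hs + 1)) / n
    + 2 / lam + (3 / σl ^ 2 + 23 / σl ^ 3) * (hx * σu + hs * (Real.log n + 2))

section FixedDeviations

variable {n : ℕ} {G : Measure ℝ} [IsProbabilityMeasure G] {s : Fin n → ℝ} {σl σu hx hs lam : ℝ}

lemma abs_phi_le_of_le {a h : ℝ} (ha : 0 < a) (z : ℝ) (hh : a ≤ h) : |phi h z| ≤ 1 / a := by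
  have h0 := ha.trans_le hh
  rw [abs_of_pos (phi_pos h0 z)]
  exact (phi_le h0 z).trans (one_div_le_one_div_of_le ha hh)

lemma abs_dphi_le_of_le {a h : ℝ} (ha : 0 < a) (z : ℝ) (hh : a ≤ h) :
    |dphi h z| ≤ 2 / a ^ 2 :=
  (abs_dphi_le (ha.trans_le hh) z).trans (by gcongr)

lemma integral_kernelError_phi_le (hσl : 0 < σl) (hsσ : ∀ j, σl ≤ s j ∧ s j ≤ σu) (hx0 : 0 < hx)
    (hs0 : 0 < hs) (hlam : 0 < lam) (i : Fin n) :
    ∫ ω, kernelError G phi hx hs s i (mkTriple (ω i) (s i)).1 ω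
        ∂(Measure.pi fun _ : Fin n => noiseLaw G)
      ≤ (lam * (1 / (hx * σl) / σl) + 2 * (1 / (hx * σl))) * weight hs s (s i) i + 1 / lam
        + 3 / σl ^ 2 * (hx * σu + hs * (Real.log n + 2)) := by
  have ha : 0 < hx * σl := mul_pos hx0 hσl
  refine integral_kernelError_self_le measurable_phi hσl hsσ hx0 hs0
    (fun h z hh => abs_phi_le_of_le ha z hh) (fun h z hh => ?_) (by positivity)
    (fun h s u hh hs => integral_phi_gaussianReal hh hs u) (by positivity)
    (fun s t z h1 h2 => abs_phi_sub_le hσl h1 h2 z)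
    (fun σ z hh => abs_phi_le_of_le hσl z hh) hlam i
  have h0 := ha.trans_le hh
  rw [sq]
  exact mul_le_mul_of_nonneg_right ((le_abs_self _).trans (abs_phi_le_of_le ha z hh))
    (phi_pos h0 z).le

/-- The constant `2 / (hx * σl) ^ 3` from `dphi_sq_le` carries the highest power of `hx⁻¹` and is
the source of the `3 * ηx` in the bandwidth condition. -/
lemma integral_kernelError_dphi_le (hσl : 0 < σl) (hsσ : ∀ j, σl ≤ s j ∧ s j ≤ σu) (hx0 : 0 < hx)
    (hs0 : 0 < hs) (hlam : 0 < lam) (i : Fin n) :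
    ∫ ω, kernelError G dphi hx hs s i (mkTriple (ω i) (s i)).1 ω
        ∂(Measure.pi fun _ : Fin n => noiseLaw G)
      ≤ (lam * (2 / (hx * σl) ^ 3 / σl) + 2 * (2 / (hx * σl) ^ 2)) * weight hs s (s i) i + 1 / lam
        + 23 / σl ^ 3 * (hx * σu + hs * (Real.log n + 2)) := by
  have ha : 0 < hx * σl := mul_pos hx0 hσl
  refine integral_kernelError_self_le measurable_dphi hσl hsσ hx0 hs0
    (fun h z hh => abs_dphi_le_of_le ha z hh) (fun h z hh => ?_) (by positivity)
    (fun h s u hh hs => integral_dphi_gaussianReal hh hs u) (by positivity)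
    (fun s t z h1 h2 => abs_dphi_sub_le hσl h1 h2 z)
    (fun σ z hh => abs_dphi_le_of_le hσl z hh) hlam i
  have h0 := ha.trans_le hh
  have := phi_pos h0 z
  exact (dphi_sq_le h0 z).trans (by gcongr)

lemma abs_estError_mkTriple_le (hσl : 0 < σl) (hsσ : ∀ j, σl ≤ s j ∧ s j ≤ σu) (hx0 : 0 < hx)
    (hs0 : 0 < hs) (i : Fin n) (ω : Fin n → ℝ × ℝ) :
    |estError G hx hs i (fun j => mkTriple (ω j) (s j))|
      ≤ (1 / (hx * σl) + 1 / σl) + (2 / (hx * σl) ^ 2 + 2 / σl ^ 2) := by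
  have ha : 0 < hx * σl := mul_pos hx0 hσl
  rw [estError_mkTriple]
  exact (abs_add_le _ _).trans (add_le_add
    (abs_kernelError_le hsσ hx0 hs0 (fun h z hh => abs_phi_le_of_le ha z hh)
      (fun σ z hh => abs_phi_le_of_le hσl z hh) i _ ω)
    (abs_kernelError_le hsσ hx0 hs0 (fun h z hh => abs_dphi_le_of_le ha z hh)
      (fun σ z hh => abs_dphi_le_of_le hσl z hh) i _ ω))

/-- Summation over `i` is essential: the self-weight of an isolated deviation can be close to `1`,
and only the sum is controlled. -/
lemma sum_integral_estError_le (hσl : 0 < σl) (hsσ : ∀ j, σl ≤ s j ∧ s j ≤ σu) (hlu : σl ≤ σu)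
    (hx0 : 0 < hx) (hs0 : 0 < hs) (hlam : 0 < lam) (hn : 0 < n) :
    ∑ i, ∫ ω, estError G hx hs i (fun j => mkTriple (ω j) (s j))
        ∂(Measure.pi fun _ : Fin n => noiseLaw G) ≤ n * errorBound σl σu hx hs lam n := by
  have ha : 0 < hx * σl := mul_pos hx0 hσl
  have hn' : (0 : ℝ) < n := by exact_mod_cast hn
  set K := lam * (1 / (hx * σl) / σl) + 2 * (1 / (hx * σl))
      + (lam * (2 / (hx * σl) ^ 3 / σl) + 2 * (2 / (hx * σl) ^ 2)) with hK
  set E := 2 / lam + (3 / σl ^ 2 + 23 / σl ^ 3) * (hx * σu + hs * (Real.log n + 2)) with hE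
  have h1 : ∀ i, ∫ ω, estError G hx hs i (fun j => mkTriple (ω j) (s j))
        ∂(Measure.pi fun _ : Fin n => noiseLaw G) ≤ K * weight hs s (s i) i + E := by
    intro i
    simp_rw [estError_mkTriple]
    rw [integral_add]
    · refine (add_le_add (integral_kernelError_phi_le hσl hsσ hx0 hs0 hlam i)
        (integral_kernelError_dphi_le hσl hsσ hx0 hs0 hlam i)).trans_eq ?_
      rw [hK, hE]; ring
    · exact integrable_of_measurable_of_abs_le (measurable_kernelError_self measurable_phi i)
        fun ω => abs_kernelError_le hsσ hx0 hs0 (fun h z hh => abs_phi_le_of_le ha z hh)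
          (fun σ z hh => abs_phi_le_of_le hσl z hh) i _ ω
    · exact integrable_of_measurable_of_abs_le (measurable_kernelError_self measurable_dphi i)
        fun ω => abs_kernelError_le hsσ hx0 hs0 (fun h z hh => abs_dphi_le_of_le ha z hh)
          (fun σ z hh => abs_dphi_le_of_le hσl z hh) i _ ω
  have h2 := sum_weight_self_le hs0 hsσ hlu
  calc _ ≤ ∑ i, (K * weight hs s (s i) i + E) := Finset.sum_le_sum fun i _ => h1 i
    _ = K * ∑ i, weight hs s (s i) i + n * E := by
      rw [Finset.sum_add_distrib, ← Finset.mul_sum]; simp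
    _ ≤ K * (2 * ((σu - σl) / hs + 1)) + n * E := by gcongr
    _ = _ := by
      rw [errorBound, ← hK, hE]; field_simp; ring

end FixedDeviations

section Risk

variable {n : ℕ} {Gμ Gσ : Measure ℝ} [IsProbabilityMeasure Gμ] [IsProbabilityMeasure Gσ]
  {C T σl σu hx hs lam τ R : ℝ}

/-- The bound for frozen deviations is uniform over configurations in `[σl, σu]`, so it survives
integration over them. -/
lemma integral_estError_le (hσl : 0 < σl) (hσ : ∀ᵐ s ∂Gσ, σl ≤ s ∧ s ≤ σu) (hlu : σl ≤ σu)
    (hx0 : 0 < hx) (hs0 : 0 < hs) (hlam : 0 < lam) (hn : 0 < n) :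
    (∀ i : Fin n, Integrable (estError Gμ hx hs i) (sampleLaw n Gμ Gσ)) ∧
    ∑ i : Fin n, ∫ D, estError Gμ hx hs i D ∂(sampleLaw n Gμ Gσ)
      ≤ n * errorBound σl σu hx hs lam n := by
  have hmp := measurePreserving_sampleLaw n Gμ Gσ (ae_pos_of_ae_mem hσl hσ)
  have hae := ae_pi_forall (ι := Fin n) hσ
  have hm := measurable_estError (n := n) Gμ hx hs
  have hi : ∀ i : Fin n, Integrable (fun q : (Fin n → ℝ × ℝ) × (Fin n → ℝ) =>
      estError Gμ hx hs i fun j => mkTriple (q.1 j) (q.2 j))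
      ((Measure.pi fun _ => noiseLaw Gμ).prod (Measure.pi fun _ => Gσ)) := by
    intro i
    refine Integrable.of_bound ((hm i).comp hmp.measurable).aestronglyMeasurable
      ((1 / (hx * σl) + 1 / σl) + (2 / (hx * σl) ^ 2 + 2 / σl ^ 2)) ?_
    filter_upwards [Measure.quasiMeasurePreserving_snd.ae hae] with q hq
    exact abs_estError_mkTriple_le hσl hq hx0 hs0 i q.1
  constructor
  · intro i
    rw [← hmp.map_eq, integrable_map_measure (hm i).aestronglyMeasurable
      hmp.measurable.aemeasurable]
    exact hi i
  · have e : ∀ i, ∫ D, estError Gμ hx hs i D ∂(sampleLaw n Gμ Gσ)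
        = ∫ s, ∫ ω, estError Gμ hx hs i (fun j => mkTriple (ω j) (s j))
          ∂(Measure.pi fun _ => noiseLaw Gμ) ∂(Measure.pi fun _ => Gσ) := by
      intro i
      rw [← hmp.map_eq, integral_map hmp.measurable.aemeasurable (hm i).aestronglyMeasurable,
        integral_prod_symm _ (hi i)]
    simp_rw [e]
    rw [← integral_finsetSum _ fun i _ => (hi i).integral_prod_right]
    refine integral_le_of_le (integrable_finsetSum _ fun i _ => (hi i).integral_prod_right) ?_
    filter_upwards [hae] with s hs'
    exact sum_integral_estError_le hσl hs' hlu hx0 hs0 hlam hn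

lemma isProbabilityMeasure_sampleLaw (hσl : 0 < σl) (hσ : ∀ᵐ s ∂Gσ, σl ≤ s ∧ s ≤ σu) :
    IsProbabilityMeasure (sampleLaw n Gμ Gσ) := by
  have := isProbabilityMeasure_tripleLaw Gμ Gσ (ae_pos_of_ae_mem hσl hσ)
  unfold sampleLaw; infer_instance

lemma integrable_nest_loss (hC : ∀ᵐ m ∂Gμ, |m| ≤ C) (hσl : 0 < σl)
    (hσ : ∀ᵐ s ∂Gσ, σl ≤ s ∧ s ≤ σu) (i : Fin n) :
    Integrable (fun D : Fin n → ℝ × ℝ × ℝ =>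
      (nest T hx hs (fun j => (D j).1) (fun j => (D j).2.2) i - (D i).2.1) ^ 2)
      (sampleLaw n Gμ Gσ) := by
  have := isProbabilityMeasure_tripleLaw Gμ Gσ (ae_pos_of_ae_mem hσl hσ)
  have := isProbabilityMeasure_sampleLaw (n := n) (Gμ := Gμ) hσl hσ
  have hae := ae_pi_forall (ι := Fin n) (ae_tripleLaw hC hσ)
  have hm : Measurable fun D : Fin n → ℝ × ℝ × ℝ => (D i).2.1 := by fun_prop
  refine Integrable.of_bound
    ((measurable_nest T hx hs i).sub hm |>.pow_const 2).aestronglyMeasurable ((|T| + C) ^ 2) ?_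
  filter_upwards [hae] with D hD
  rw [norm_pow, Real.norm_eq_abs]
  gcongr
  exact (abs_sub _ _).trans (add_le_add (abs_clip_le _ _) (hD i).1)

lemma integrable_compoundLoss_nest (hC : ∀ᵐ m ∂Gμ, |m| ≤ C) (hσl : 0 < σl)
    (hσ : ∀ᵐ s ∂Gσ, σl ≤ s ∧ s ≤ σu) :
    Integrable (compoundLoss (nest (n := n) T hx hs)) (sampleLaw n Gμ Gσ) :=
  (integrable_finsetSum _ fun i _ => integrable_nest_loss hC hσl hσ i).const_mul _

lemma integrable_oracleLoss (hC : ∀ᵐ m ∂Gμ, |m| ≤ C) (hσl : 0 < σl)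
    (hσ : ∀ᵐ s ∂Gσ, σl ≤ s ∧ s ≤ σu) :
    Integrable (oracleLoss Gμ) (tripleLaw Gμ Gσ) := by
  have := isProbabilityMeasure_tripleLaw Gμ Gσ (ae_pos_of_ae_mem hσl hσ)
  have hae := ae_tripleLaw hC hσ
  have hp : Measurable fun p : ℝ × ℝ × ℝ => (p.2.2, p.1) := by fun_prop
  have h1 := (measurable_marginal (G := Gμ)).comp hp
  have h2 := (measurable_dmarginal (G := Gμ)).comp hp
  have hm : Measurable fun p : ℝ × ℝ × ℝ =>
      (p.1 + p.2.2 ^ 2 * (dmarginal Gμ p.2.2 p.1 / marginal Gμ p.2.2 p.1) - p.2.1) ^ 2 := by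
    refine Measurable.pow_const (Measurable.sub (Measurable.add (by fun_prop) ?_) (by fun_prop)) 2
    exact Measurable.mul (by fun_prop) (h2.div h1)
  refine Integrable.of_bound (hm.aestronglyMeasurable.congr ?_) ((C + C) ^ 2) ?_
  · filter_upwards [hae] with p hp
    rw [oracleLoss, oracle_eq (hσl.trans_le hp.2.1)]
  · filter_upwards [hae] with p hp
    rw [oracleLoss, norm_pow, Real.norm_eq_abs]
    gcongr
    exact (abs_sub _ _).trans (add_le_add (abs_oracle_le (hσl.trans_le hp.2.1) hC _) hp.1)

/-- The difference of the squared errors of the NEST rule and of the oracle rule. -/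
lemma abs_nest_loss_sub_oracleLoss_le (hC : ∀ᵐ m ∂Gμ, |m| ≤ C) (hσl : 0 < σl) (hCT : C ≤ T)
    (hτ : 0 < τ) (hτ1 : τ ≤ 1) (i : Fin n) {D : Fin n → ℝ × ℝ × ℝ}
    (hD : |(D i).2.1| ≤ C ∧ σl ≤ (D i).2.2 ∧ (D i).2.2 ≤ σu) :
    |(nest T hx hs (fun j => (D j).1) (fun j => (D j).2.2) i - (D i).2.1) ^ 2
        - oracleLoss Gμ (D i)|
      ≤ (T + 3 * C) * (2 * T * {p | marginal Gμ p.2.2 p.1 < τ}.indicator (fun _ => (1 : ℝ)) (D i)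
        + (4 * T + 2 * σu ^ 2 * (1 + 2 / σl ^ 2)) / τ ^ 2 * estError Gμ hx hs i D) := by
  have hs0 : 0 < (D i).2.2 := hσl.trans_le hD.2.1
  have hC0 : 0 ≤ C := (abs_nonneg _).trans hD.1
  have hT0 : 0 ≤ T := hC0.trans hCT
  have ho := abs_oracle_le hs0 hC (D i).1
  have hn : |nest T hx hs (fun j => (D j).1) (fun j => (D j).2.2) i| ≤ T := by
    have := abs_clip_le T (nestRaw hx hs (fun j => (D j).1) (fun j => (D j).2.2) i)
    rwa [abs_of_nonneg hT0] at this
  have he : 0 ≤ estError Gμ hx hs i D := by unfold estError; positivity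
  have hK : 0 ≤ (4 * T + 2 * σu ^ 2 * (1 + 2 / σl ^ 2)) / τ ^ 2 := by positivity
  have key : |nest T hx hs (fun j => (D j).1) (fun j => (D j).2.2) i
      - oracle Gμ (D i).1 (D i).2.2|
      ≤ 2 * T * {p | marginal Gμ p.2.2 p.1 < τ}.indicator (fun _ => (1 : ℝ)) (D i)
        + (4 * T + 2 * σu ^ 2 * (1 + 2 / σl ^ 2)) / τ ^ 2 * estError Gμ hx hs i D := by
    -- Where the density is small only the trivial bound `T + C ≤ 2 * T` is used.
    by_cases hlt : marginal Gμ (D i).2.2 (D i).1 < τ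
    · rw [Set.indicator_of_mem (by exact hlt), mul_one]
      have := mul_nonneg hK he
      have := (abs_sub _ _).trans (add_le_add hn ho)
      linarith
    · rw [Set.indicator_of_notMem (by exact hlt), mul_zero, zero_add]
      rw [oracle_eq hs0] at ho ⊢
      unfold nest nestRaw estError
      rw [deriv_kde]
      refine abs_nest_sub_le hτ hτ1 (not_lt.1 hlt) (ho.trans hCT) ?_ ?_
      · have := hD.2.2; gcongr
      · refine (abs_dmarginal_le hs0 _).trans ?_
        have := hD.2.1; gcongr
  -- Difference of two squares; the sum factor is at most `T + C + 2 * C`.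
  have e : (nest T hx hs (fun j => (D j).1) (fun j => (D j).2.2) i - (D i).2.1) ^ 2
        - oracleLoss Gμ (D i)
      = (nest T hx hs (fun j => (D j).1) (fun j => (D j).2.2) i + oracle Gμ (D i).1 (D i).2.2
          - 2 * (D i).2.1) *
        (nest T hx hs (fun j => (D j).1) (fun j => (D j).2.2) i
          - oracle Gμ (D i).1 (D i).2.2) := by
    unfold oracleLoss; ring
  rw [e, abs_mul]
  refine mul_le_mul ?_ key (abs_nonneg _) (by positivity)
  rw [abs_le] at hn ho ⊢
  have := abs_le.1 hD.1
  constructor <;> linarith [hn.1, hn.2, ho.1, ho.2, this.1, this.2]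

/-- Nonasymptotic, with `lam`, `τ`, `R` free: small `τ` makes low densities rare but inflates the
estimation error by `τ⁻²`, and `R` balances the two parts of the small-density probability. -/
theorem abs_compoundRisk_sub_oracleRisk_le (hC : ∀ᵐ m ∂Gμ, |m| ≤ C) (hσl : 0 < σl)
    (hσ : ∀ᵐ s ∂Gσ, σl ≤ s ∧ s ≤ σu) (hCT : C ≤ T) (hx0 : 0 < hx) (hs0 : 0 < hs) (hlam : 0 < lam)
    (hτ : 0 < τ) (hτ1 : τ ≤ 1) (hR : 0 < R) (hn : 0 < n) :
    |compoundRisk (nest (n := n) T hx hs) Gμ Gσ - oracleRisk Gμ Gσ|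
      ≤ (T + 3 * C) * (2 * T * (2 * R * τ + (2 * C ^ 2 + 2 * σu ^ 2) / R ^ 2)
        + (4 * T + 2 * σu ^ 2 * (1 + 2 / σl ^ 2)) / τ ^ 2 * errorBound σl σu hx hs lam n) := by
  have := isProbabilityMeasure_tripleLaw Gμ Gσ (ae_pos_of_ae_mem hσl hσ)
  have := isProbabilityMeasure_sampleLaw (n := n) (Gμ := Gμ) hσl hσ
  have hn' : (0 : ℝ) < n := by exact_mod_cast hn
  have hlu : σl ≤ σu := by obtain ⟨s, hs⟩ := hσ.exists; exact hs.1.trans hs.2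
  have hC0 : 0 ≤ C := by obtain ⟨m, hm⟩ := hC.exists; exact (abs_nonneg _).trans hm
  have hT0 : 0 ≤ T := hC0.trans hCT
  have hae := ae_pi_forall (ι := Fin n) (ae_tripleLaw hC hσ)
  have hloss := fun i : Fin n => integrable_nest_loss (T := T) (hx := hx) (hs := hs) hC hσl hσ i
  have hol := integrable_oracleLoss hC hσl hσ
  have hev := fun i : Fin n => measurePreserving_eval (fun _ : Fin n => tripleLaw Gμ Gσ) i
  have hol' : ∀ i : Fin n, Integrable (fun D : Fin n → ℝ × ℝ × ℝ => oracleLoss Gμ (D i))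
      (sampleLaw n Gμ Gσ) := fun i => (hev i).integrable_comp_of_integrable hol
  have hor : ∀ i : Fin n, ∫ D, oracleLoss Gμ (D i) ∂(sampleLaw n Gμ Gσ) = oracleRisk Gμ Gσ := by
    intro i
    rw [oracleRisk, ← (hev i).map_eq, integral_map (hev i).measurable.aemeasurable]
    · rfl
    · rw [(hev i).map_eq]; exact hol.aestronglyMeasurable
  set S := {p : ℝ × ℝ × ℝ | marginal Gμ p.2.2 p.1 < τ}
  have hS : MeasurableSet S := measurableSet_lt (measurable_marginal.comp
    (by fun_prop : Measurable fun p : ℝ × ℝ × ℝ => (p.2.2, p.1))) measurable_const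
  have hSi : Integrable (S.indicator fun _ => (1 : ℝ)) (tripleLaw Gμ Gσ) :=
    (integrable_const _).indicator hS
  have hSi' : ∀ i : Fin n, Integrable
      (fun D : Fin n → ℝ × ℝ × ℝ => S.indicator (fun _ => (1 : ℝ)) (D i))
      (sampleLaw n Gμ Gσ) := fun i => (hev i).integrable_comp_of_integrable hSi
  have hSe : ∀ i : Fin n, ∫ D, S.indicator (fun _ => (1 : ℝ)) (D i) ∂(sampleLaw n Gμ Gσ)
      ≤ 2 * R * τ + (2 * C ^ 2 + 2 * σu ^ 2) / R ^ 2 := by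
    intro i
    refine le_trans (le_of_eq ?_) (tripleLaw_marginal_lt_le hC hσl hσ hR hτ)
    have h1 : ∫ p, S.indicator (fun _ => (1 : ℝ)) p ∂(tripleLaw Gμ Gσ)
        = (tripleLaw Gμ Gσ).real S := integral_indicator_one hS
    rw [← h1, ← (hev i).map_eq, integral_map (hev i).measurable.aemeasurable]
    · rfl
    · rw [(hev i).map_eq]; exact hSi.aestronglyMeasurable
  obtain ⟨hei, hes⟩ := integral_estError_le (Gμ := Gμ) hσl hσ hlu hx0 hs0 hlam hn
  set p := 2 * R * τ + (2 * C ^ 2 + 2 * σu ^ 2) / R ^ 2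
  set K := (4 * T + 2 * σu ^ 2 * (1 + 2 / σl ^ 2)) / τ ^ 2 with hK
  have hK0 : 0 ≤ K := by positivity
  have hdiff : compoundRisk (nest (n := n) T hx hs) Gμ Gσ - oracleRisk Gμ Gσ
      = (n : ℝ)⁻¹ * ∑ i : Fin n, ∫ D, ((nest T hx hs (fun j => (D j).1) (fun j => (D j).2.2) i
        - (D i).2.1) ^ 2 - oracleLoss Gμ (D i)) ∂(sampleLaw n Gμ Gσ) := by
    simp_rw [fun i => integral_sub (hloss i) (hol' i), hor]
    rw [Finset.sum_sub_distrib, mul_sub, compoundRisk]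
    unfold compoundLoss
    rw [integral_const_mul, integral_finsetSum _ fun i _ => hloss i]
    simp [hn'.ne']
  have hterm : ∀ i : Fin n, |∫ D, ((nest T hx hs (fun j => (D j).1) (fun j => (D j).2.2) i
        - (D i).2.1) ^ 2 - oracleLoss Gμ (D i)) ∂(sampleLaw n Gμ Gσ)|
      ≤ (T + 3 * C) * (2 * T * p + K * ∫ D, estError Gμ hx hs i D ∂(sampleLaw n Gμ Gσ)) := by
    intro i
    have hint := (((hSi' i).const_mul (2 * T)).add ((hei i).const_mul K)).const_mul (T + 3 * C)
    have h1 := norm_integral_le_of_norm_le hint (f := fun D => (nest T hx hs (fun j => (D j).1)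
      (fun j => (D j).2.2) i - (D i).2.1) ^ 2 - oracleLoss Gμ (D i)) (by
        filter_upwards [hae] with D hD
        exact abs_nest_loss_sub_oracleLoss_le hC hσl hCT hτ hτ1 i (hD i))
    refine h1.trans ?_
    rw [integral_const_mul]
    refine mul_le_mul_of_nonneg_left ?_ (by positivity)
    rw [integral_add' ((hSi' i).const_mul (2 * T)) ((hei i).const_mul K), integral_const_mul,
      integral_const_mul]
    have := hSe i
    gcongr
  rw [hdiff, abs_mul, abs_of_pos (inv_pos.2 hn')]
  calc _ ≤ (n : ℝ)⁻¹ * ∑ i : Fin n, (T + 3 * C) * (2 * T * p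
        + K * ∫ D, estError Gμ hx hs i D ∂(sampleLaw n Gμ Gσ)) := by
        gcongr
        exact (Finset.abs_sum_le_sum_abs _ _).trans (Finset.sum_le_sum fun i _ => hterm i)
    _ = (T + 3 * C) * (2 * T * p + K * ((n : ℝ)⁻¹ *
        ∑ i : Fin n, ∫ D, estError Gμ hx hs i D ∂(sampleLaw n Gμ Gσ))) := by
        rw [← Finset.mul_sum, Finset.sum_add_distrib, ← Finset.mul_sum]
        simp only [Finset.sum_const, Finset.card_univ, Fintype.card_fin, nsmul_eq_mul]
        field_simp
        rw [← Finset.mul_sum]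
    _ ≤ (T + 3 * C) * (2 * T * p + K * ((n : ℝ)⁻¹ * (n * errorBound σl σu hx hs lam n))) := by
        gcongr
    _ = _ := by rw [inv_mul_cancel_left₀ hn'.ne']

end Risk

/-! ### Asymptotics -/

section PowerBounds

variable {f g : ℕ → ℝ} {a b : ℝ}

lemma isBigO_rpow_mono (hf : f =O[atTop] fun n : ℕ => (n : ℝ) ^ a) (hab : a ≤ b) :
    f =O[atTop] fun n : ℕ => (n : ℝ) ^ b := by
  refine hf.trans (IsBigO.of_bound 1 ?_)
  filter_upwards [eventually_ge_atTop 1] with n hn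
  have hn' : (1 : ℝ) ≤ n := by exact_mod_cast hn
  rw [one_mul, Real.norm_of_nonneg (by positivity), Real.norm_of_nonneg (by positivity)]
  exact Real.rpow_le_rpow_of_exponent_le hn' hab

lemma isBigO_rpow_mul (hf : f =O[atTop] fun n : ℕ => (n : ℝ) ^ a)
    (hg : g =O[atTop] fun n : ℕ => (n : ℝ) ^ b) :
    (fun n => f n * g n) =O[atTop] fun n : ℕ => (n : ℝ) ^ (a + b) := by
  refine (hf.mul hg).congr' EventuallyEq.rfl ?_
  filter_upwards [eventually_ge_atTop 1] with n hn
  have hn' : (0 : ℝ) < n := by exact_mod_cast hn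
  rw [Real.rpow_add hn']

lemma isBigO_rpow_pow (hf : f =O[atTop] fun n : ℕ => (n : ℝ) ^ a) (k : ℕ) :
    (fun n => f n ^ k) =O[atTop] fun n : ℕ => (n : ℝ) ^ (a * k) := by
  refine (hf.pow k).congr' EventuallyEq.rfl ?_
  filter_upwards with n
  rw [Real.rpow_mul (by positivity), Real.rpow_natCast]

lemma isBigO_const_rpow (c : ℝ) (ha : 0 ≤ a) :
    (fun _ : ℕ => c) =O[atTop] fun n : ℕ => (n : ℝ) ^ a := by
  refine isBigO_rpow_mono (a := 0) ?_ ha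
  simpa using isBigO_const_const c (one_ne_zero (α := ℝ)) (atTop : Filter ℕ)

lemma isTheta_inv_rpow (hf : f =Θ[atTop] fun n : ℕ => (n : ℝ) ^ (-a)) :
    (fun n => (f n)⁻¹) =O[atTop] fun n : ℕ => (n : ℝ) ^ a := by
  refine hf.inv.1.congr' EventuallyEq.rfl ?_
  filter_upwards with n
  rw [Real.rpow_neg (by positivity), inv_inv]

lemma tendsto_zero_of_isBigO_rpow (hf : f =O[atTop] fun n : ℕ => (n : ℝ) ^ a) (ha : a < 0) :
    Tendsto f atTop (𝓝 0) := by
  refine hf.trans_tendsto ?_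
  have := (tendsto_rpow_neg_atTop (neg_pos.2 ha)).comp (tendsto_natCast_atTop_atTop (R := ℝ))
  simpa [Function.comp_def] using this

lemma isBigO_log_rpow (ha : 0 < a) :
    (fun n : ℕ => Real.log n) =O[atTop] fun n : ℕ => (n : ℝ) ^ a :=
  (isLittleO_log_rpow_atTop ha).isBigO.comp_tendsto tendsto_natCast_atTop_atTop

end PowerBounds

lemma isBigO_errorBound (σl σu : ℝ) {ηx ηs : ℝ} (hηx : 0 < ηx) (hηs : 0 < ηs)
    (hη : 3 * ηx + ηs < 1) {hx hs : ℕ → ℝ}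
    (hx_rate : hx =Θ[atTop] fun n : ℕ => (n : ℝ) ^ (-ηx))
    (hs_rate : hs =Θ[atTop] fun n : ℕ => (n : ℝ) ^ (-ηs)) :
    ∃ κ ρ : ℝ, 0 < ρ ∧ (fun n : ℕ => errorBound σl σu (hx n) (hs n) ((n : ℝ) ^ κ) n)
      =O[atTop] fun n : ℕ => (n : ℝ) ^ (-ρ) := by
  -- Half the slack in the bandwidth condition: the variance term has exponent `κ + 3 * ηx + ηs - 1
  -- = -κ`, the same as `1 / lam`.
  set κ := (1 - 3 * ηx - ηs) / 2 with hκ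
  have hκ0 : 0 < κ := by rw [hκ]; linarith
  -- `ηs / 2` instead of `ηs`, because half of the power of `hs` absorbs `log n`.
  refine ⟨κ, min κ (min ηx (ηs / 2)), by positivity, ?_⟩
  set ρ := min κ (min ηx (ηs / 2))
  have hρ1 : ρ ≤ κ := min_le_left _ _
  have hρ2 : ρ ≤ ηx := (min_le_right _ _).trans (min_le_left _ _)
  have hρ3 : ρ ≤ ηs / 2 := (min_le_right _ _).trans (min_le_right _ _)
  have hxi := isTheta_inv_rpow hx_rate
  have hsi := isTheta_inv_rpow hs_rate
  have hlam : (fun n : ℕ => (n : ℝ) ^ κ) =O[atTop] fun n : ℕ => (n : ℝ) ^ κ := isBigO_refl _ _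
  have hlami : (fun n : ℕ => ((n : ℝ) ^ κ)⁻¹) =O[atTop] fun n : ℕ => (n : ℝ) ^ (-κ) :=
    (isBigO_refl _ _).congr' (by filter_upwards with n; rw [Real.rpow_neg (by positivity)])
      EventuallyEq.rfl
  have hni : (fun n : ℕ => (n : ℝ)⁻¹) =O[atTop] fun n : ℕ => (n : ℝ) ^ (-1 : ℝ) :=
    (isBigO_refl _ _).congr' (by filter_upwards with n; rw [Real.rpow_neg_one]) EventuallyEq.rfl
  have hA : (fun n : ℕ => 1 / (σl * σl) * ((n : ℝ) ^ κ * (hx n)⁻¹) + 2 / σl * (hx n)⁻¹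
      + (2 / σl ^ 4 * ((n : ℝ) ^ κ * (hx n)⁻¹ ^ 3) + 4 / σl ^ 2 * (hx n)⁻¹ ^ 2))
      =O[atTop] fun n : ℕ => (n : ℝ) ^ (κ + 3 * ηx) := by
    refine ((IsBigO.const_mul_left ?_ _).add (IsBigO.const_mul_left ?_ _)).add
      ((IsBigO.const_mul_left ?_ _).add (IsBigO.const_mul_left ?_ _))
    · exact isBigO_rpow_mono (isBigO_rpow_mul hlam hxi) (by linarith)
    · exact isBigO_rpow_mono hxi (by linarith)
    · exact isBigO_rpow_mono (isBigO_rpow_mul hlam (isBigO_rpow_pow hxi 3))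
        (by push_cast; linarith)
    · exact isBigO_rpow_mono (isBigO_rpow_pow hxi 2) (by push_cast; linarith)
  have hB : (fun n => 2 * (σu - σl) * (hs n)⁻¹ + 2) =O[atTop] fun n : ℕ => (n : ℝ) ^ ηs :=
    (hsi.const_mul_left _).add (isBigO_const_rpow 2 hηs.le)
  have hD : (fun n : ℕ => hs n * (Real.log n + 2)) =O[atTop] fun n : ℕ => (n : ℝ) ^ (-ρ) :=
    isBigO_rpow_mono (isBigO_rpow_mul hs_rate.1
      ((isBigO_log_rpow (half_pos hηs)).add (isBigO_const_rpow 2 (half_pos hηs).le)))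
      (by linarith)
  have hF := ((isBigO_rpow_mono (isBigO_rpow_mul (isBigO_rpow_mul hA hB) hni)
    (b := -ρ) (by linarith)).add ((isBigO_rpow_mono hlami (b := -ρ) (by linarith)).const_mul_left
      2)).add ((((isBigO_rpow_mono hx_rate.1 (b := -ρ) (by linarith)).const_mul_left σu).add
        hD).const_mul_left (3 / σl ^ 2 + 23 / σl ^ 3))
  refine hF.congr_left fun n => ?_
  unfold errorBound
  simp only [div_eq_mul_inv, mul_inv, mul_pow, inv_pow]
  ring

end NEST

end

/-! ### Choice of the free parameters and the limit. -/

open NEST in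
theorem theorem4p1
    -- the priors, which may change with the number `n` of observations
    (Gμ Gσ : ℕ → Measure ℝ)
    [∀ n, IsProbabilityMeasure (Gμ n)] [∀ n, IsProbabilityMeasure (Gσ n)]
    -- the means are bounded by `C n`, which grows slower than every power of `n`
    (C : ℕ → ℝ) (hC : ∀ n, ∀ᵐ m ∂(Gμ n), |m| ≤ C n)
    (hCo : ∀ ε : ℝ, 0 < ε → C =o[atTop] fun n : ℕ => (n : ℝ) ^ ε)
    -- the standard deviations are bounded above and away from zero
    (σl σu : ℝ) (hσl : 0 < σl) (hσ : ∀ n, ∀ᵐ s ∂(Gσ n), σl ≤ s ∧ s ≤ σu)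
    -- the truncation level
    (T : ℕ → ℝ) (hCT : ∀ᶠ n in atTop, C n ≤ T n)
    (hTo : ∀ ε : ℝ, 0 < ε → T =o[atTop] fun n : ℕ => (n : ℝ) ^ ε)
    -- the bandwidths
    (ηx ηs : ℝ) (hηx : 0 < ηx) (hηs : 0 < ηs) (hη : 3 * ηx + ηs < 1)
    (hx hs : ℕ → ℝ) (hx_pos : ∀ n, 0 < n → 0 < hx n) (hs_pos : ∀ n, 0 < n → 0 < hs n)
    (hx_rate : hx =Θ[atTop] fun n : ℕ => (n : ℝ) ^ (-ηx))
    (hs_rate : hs =Θ[atTop] fun n : ℕ => (n : ℝ) ^ (-ηs)) :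
    (∀ n, Integrable (NEST.compoundLoss (NEST.nest (n := n) (T n) (hx n) (hs n)))
      (NEST.sampleLaw n (Gμ n) (Gσ n))) ∧
    (∀ n, Integrable (NEST.oracleLoss (Gμ n)) (NEST.tripleLaw (Gμ n) (Gσ n))) ∧
    Tendsto (fun n : ℕ =>
        NEST.compoundRisk (NEST.nest (n := n) (T n) (hx n) (hs n)) (Gμ n) (Gσ n)
          - NEST.oracleRisk (Gμ n) (Gσ n))
      atTop (𝓝 0) := by
  refine ⟨fun n => integrable_compoundLoss_nest (hC n) hσl (hσ n),
    fun n => integrable_oracleLoss (hC n) hσl (hσ n), ?_⟩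
  obtain ⟨κ, ρ, hρ, hE⟩ := isBigO_errorBound σl σu hηx hηs hη hx_rate hs_rate
  -- Any sufficiently small multiple of `ρ` serves as exponent for `C` and `T`.
  have hCb := (hCo (ρ / 64) (by positivity)).isBigO
  have hTb := (hTo (ρ / 64) (by positivity)).isBigO
  have hpow : ∀ a : ℝ, (fun n : ℕ => (n : ℝ) ^ a) =O[atTop] fun n : ℕ => (n : ℝ) ^ a :=
    fun a => isBigO_refl _ _
  have hδ : 0 ≤ ρ / 64 := by positivity
  -- the bandwidth-free part, with `R = n ^ (ρ / 8)` and `τ = n ^ (-(ρ / 4))`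
  have hP : (fun n : ℕ => 2 * (n : ℝ) ^ (-(ρ / 8))
      + (2 * C n ^ 2 + 2 * σu ^ 2) * (n : ℝ) ^ (-(ρ / 4)))
      =O[atTop] fun n : ℕ => (n : ℝ) ^ (-(ρ / 8)) := by
    refine ((hpow _).const_mul_left _).add (isBigO_rpow_mono (isBigO_rpow_mul
      (((isBigO_rpow_pow hCb 2).const_mul_left 2).add (isBigO_const_rpow _ (by positivity)))
      (hpow _)) ?_)
    push_cast; linarith
  have hK : (fun n : ℕ => (4 * T n + 2 * σu ^ 2 * (1 + 2 / σl ^ 2)) * (n : ℝ) ^ (ρ / 2))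
      =O[atTop] fun n : ℕ => (n : ℝ) ^ (ρ / 64 + ρ / 2) :=
    isBigO_rpow_mul ((hTb.const_mul_left 4).add (isBigO_const_rpow _ hδ)) (hpow _)
  -- The exponents inside the bracket are `ρ/64 - ρ/8` for small densities and `ρ/64 + ρ/2 - ρ` for
  -- estimation, both below `-ρ/16`; the outer factor adds `ρ/64`, which leaves a negative power.
  have hbound := isBigO_rpow_mul (hTb.add (hCb.const_mul_left 3))
    ((isBigO_rpow_mono (isBigO_rpow_mul (hTb.const_mul_left 2) hP)
      (b := -(ρ / 16)) (by linarith)).add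
      (isBigO_rpow_mono (isBigO_rpow_mul hK hE) (b := -(ρ / 16)) (by linarith)))
  refine squeeze_zero_norm' ?_ (tendsto_zero_of_isBigO_rpow hbound (by linarith))
  filter_upwards [hCT, eventually_ge_atTop 1] with n hn hn1
  have hn0 : (0 : ℝ) < n := by exact_mod_cast hn1
  have hn1' : (1 : ℝ) ≤ n := by exact_mod_cast hn1
  refine (abs_compoundRisk_sub_oracleRisk_le (hC n) hσl (hσ n) hn (hx_pos n hn1) (hs_pos n hn1)
    (lam := (n : ℝ) ^ κ) (τ := (n : ℝ) ^ (-(ρ / 4))) (R := (n : ℝ) ^ (ρ / 8))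
    (by positivity) (by positivity)
    (Real.rpow_le_one_of_one_le_of_nonpos hn1' (by linarith)) (by positivity) hn1).trans_eq ?_
  have e1 : (n : ℝ) ^ (ρ / 8) * (n : ℝ) ^ (-(ρ / 4)) = (n : ℝ) ^ (-(ρ / 8)) := by
    rw [← Real.rpow_add hn0]; ring_nf
  have e2 : (((n : ℝ) ^ (ρ / 8)) ^ 2)⁻¹ = (n : ℝ) ^ (-(ρ / 4)) := by
    rw [← Real.rpow_natCast, ← Real.rpow_mul hn0.le, ← Real.rpow_neg hn0.le]; push_cast; ring_nf
  have e3 : (((n : ℝ) ^ (-(ρ / 4))) ^ 2)⁻¹ = (n : ℝ) ^ (ρ / 2) := by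
    rw [← Real.rpow_natCast, ← Real.rpow_mul hn0.le, ← Real.rpow_neg hn0.le]; push_cast; ring_nf
  rw [mul_assoc 2 ((n : ℝ) ^ (ρ / 8)), e1, div_eq_mul_inv _ (((n : ℝ) ^ (ρ / 8)) ^ 2), e2,
    div_eq_mul_inv _ (((n : ℝ) ^ (-(ρ / 4))) ^ 2), e3]
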